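/- **Setting.** Fix a time $t$. Let $(c_m,\delta_m)_{m\ge1}$ be i.i.d. pairs of real random variables and $(b_n,\omega_n,\theta_n)_{n\ge 1}$ i.i.d. triples of real random variables, the two families being independent of each other, with $\mathbb E[c_1^2]<\infty$ and $\mathbb E[b_1^2]<\infty$. Here $c_m$ and $\delta_m$ are the amplitude and the random phase error of the $m$-th column of a reconfigurable intelligent surface (RIS), and $b_n,\omega_n,\theta_n$ are the amplitude, Doppler frequency and phase of the $n$-th multipath component of the direct link. Let $\omega_0,\theta_0,\epsilon\in\mathbb R$ and $(\bar\phi_m)_{m\ge1}\subset\mathbb R$ be deterministic parameters ($\bar\phi_m$ is the nominal phase shift of column $m$, and $\phi_m=\bar\phi_m+\delta_m$ is the actual one). For $M$ columns and $N$ multipath components the in-phase and quadrature components are $$T_c=\sum_{m=1}^{M}c_m\cos(\omega_0t+\theta_0-\epsilon m+\phi_m)+\sum_{n=1}^{N}b_n\cos(\omega_nt+\theta_n),$$ $$T_s=\sum_{m=1}^{M}c_m\sin(\omega_0t+\theta_0-\epsilon m+\phi_m)+\sum_{n=1}^{N}b_n\sin(\omega_nt+\theta_n),$$ and $\tilde R=T_c+jT_s$.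 Put $$\Xi^2=\mathbb E[T_c]^2+\mathbb E[T_s]^2,\quad \sigma=\mathrm{Var}(T_c)+\mathrm{Var}(T_s),\quad \Omega=\Xi^2+\sigma,\quad K^{\mathrm{Eff}}=\frac{\Xi^2}{\sigma},\quad m^*=\frac{(\sigma+\Xi^2)^2}{(\sigma+\Xi^2)^2-\Xi^4}.$$ $\mathrm{Rice}(K,\Omega)$ is the law on $(0,\infty)$ with density $\frac{2x(K+1)}{\Omega}e^{-K-(K+1)x^2/\Omega}I_0\bigl(2x\sqrt{K(K+1)/\Omega}\bigr)$, where $I_0$ is the modified Bessel function of order zero, and $\mathrm{Nak}(m,\Omega)$ is the law on $(0,\infty)$ with density $\frac{2m^m}{\Gamma(m)\Omega^m}x^{2m-1}e^{-mx^2/\Omega}$. Call a choice of $M,N$ and of the deterministic parameters *balanced* if $\sigma>0$, $\mathrm{Var}(T_c)=\mathrm{Var}(T_s)$ and $\mathrm{Cov}(T_c,T_s)=0$. The Kolmogorov distance of two laws is the supremum of the absolute difference of their distribution functions. **Theorem.** 1. For every $\eta>0$ there are $n_0\in\mathbb N$ and $L>0$ such that for all $M,N\ge n_0$ and all deterministic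 parameters $\omega_0,\theta_0,\epsilon,(\bar\phi_m)$ for which the choice is balanced: (a) the Kolmogorov distance between the law of $|\tilde R|$ and $\mathrm{Rice}(K^{\mathrm{Eff}},\Omega)$ is at most $\eta$; (b) if $K^{\mathrm{Eff}}\le 1/L$ or $K^{\mathrm{Eff}}\ge L$, the Kolmogorov distance between the law of $|\tilde R|$ and $\mathrm{Nak}(m^*,\Omega)$ is at most $\eta$. 2. Let the deterministic parameters be fixed with $\bar\phi_m=\epsilon m$ for all $m$, so that the RIS terms are identically distributed. For every $\eta>0$ there is $n_0$ such that, for all $M=N\ge n_0$ for which the choice is balanced, the Kolmogorov distance between the law of $|\tilde R|$ and $\mathrm{Nak}(m^*,\Omega)$ is at most $\eta$. 3. For all $M,N$ and all deterministic parameters for which the choice is balanced, $\mathbb E[|\tilde R|^2]=\Omega$, $m^*>0$, and $\mathrm{Nak}(m^*,\Omega)$ is the Nakagami law equivalent to $\mathrm{Rice}(K^{\mathrm{Eff}},\Omega)$: for $m',\Omega'>0$, the laws $\mathrm{Nak}(m',\Omega')$ and $\mathrm{Rice}(K^{\mathrm{Eff}},\Omega)$ have the same second and the same fourth moments if and only if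 $m'=m^*$ and $\Omega'=\Omega$. -/

import Mathlib

open MeasureTheory ProbabilityTheory Set

noncomputable section

namespace RIS

/-- Modified Bessel function of the first kind of order zero,
`I₀(z) = (1/π) ∫₀^π exp (z cos u) du`. -/
def besselI0 (z : ℝ) : ℝ :=
  Real.pi⁻¹ * ∫ u in (0 : ℝ)..Real.pi, Real.exp (z * Real.cos u)

/-- Density on `x > 0` of the Rician law with shape factor `K` and scale factor (mean square) `Ωp`. -/
def ricianPDF (K Ωp x : ℝ) : ℝ :=
  2 * x * (K + 1) / Ωp * Real.exp (-K - (K + 1) * x ^ 2 / Ωp)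
    * besselI0 (2 * x * √(K * (K + 1) / Ωp))

/-- The Rician law; meaningful for `0 ≤ K` and `0 < Ωp`. -/
def ricianMeasure (K Ωp : ℝ) : Measure ℝ :=
  (volume.restrict (Ioi 0)).withDensity fun x ↦ ENNReal.ofReal (ricianPDF K Ωp x)

/-- Density on `x > 0` of the Nakagami law with shape `m` and mean square `Ωp`. -/
def nakagamiPDF (m Ωp x : ℝ) : ℝ :=
  2 * m ^ m / (Real.Gamma m * Ωp ^ m) * x ^ (2 * m - 1) * Real.exp (-m * x ^ 2 / Ωp)

/-- The Nakagami law; meaningful for `0 < m` and `0 < Ωp`. -/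
def nakagamiMeasure (m Ωp : ℝ) : Measure ℝ :=
  (volume.restrict (Ioi 0)).withDensity fun x ↦ ENNReal.ofReal (nakagamiPDF m Ωp x)

/-- The random quantities of the channel. Components are numbered from `0`. -/
structure Randomness (S : Type*) where
  /-- amplitude reflected by each RIS column -/
  c : ℕ → S → ℝ
  /-- random phase error of each RIS column (identically zero for an exact phase shift) -/
  δ : ℕ → S → ℝ
  /-- amplitude of each direct multipath component -/
  b : ℕ → S → ℝ
  /-- Doppler angular frequency of each direct multipath component -/
  ω : ℕ → S → ℝ
  /-- phase of each direct multipath component -/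
  θ : ℕ → S → ℝ

/-- The deterministic quantities: Doppler frequency `ω₀` and fixed phase `θ₀` of the RIS link, phase
increment `ε` between neighbouring columns, and the nominal phase shift `φ` of each column. The
phase shift that a column actually applies is its nominal one plus its phase error. -/
structure Config where
  ω₀ : ℝ
  θ₀ : ℝ
  ε : ℝ
  φ : ℕ → ℝ

variable {S : Type*} [MeasurableSpace S]

/-- The statistical model: the pairs (amplitude, phase error) of the RIS columns are i.i.d., the
triples (amplitude, Doppler frequency, phase) of the direct multipath components are i.i.d., the two
families are independent of each other, and the amplitudes are square integrable. -/
structure Randomness.IsIID (X : Randomness S) (μ : Measure S) : Prop where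
  identDistrib_ris : ∀ m, IdentDistrib (fun s ↦ (X.c m s, X.δ m s)) (fun s ↦ (X.c 0 s, X.δ 0 s)) μ μ
  iIndep_ris : iIndepFun (fun m s ↦ (X.c m s, X.δ m s)) μ
  identDistrib_direct : ∀ n, IdentDistrib (fun s ↦ (X.b n s, X.ω n s, X.θ n s))
    (fun s ↦ (X.b 0 s, X.ω 0 s, X.θ 0 s)) μ μ
  iIndep_direct : iIndepFun (fun n s ↦ (X.b n s, X.ω n s, X.θ n s)) μ
  indep : IndepFun (fun s m ↦ (X.c m s, X.δ m s)) (fun s n ↦ (X.b n s, X.ω n s, X.θ n s)) μ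
  memLp_c : MemLp (X.c 0) 2 μ
  memLp_b : MemLp (X.b 0) 2 μ

/-- In-phase component at time `t`, with `M` RIS columns and `N` direct multipath components. -/
def Tc (X : Randomness S) (g : Config) (t : ℝ) (M N : ℕ) (s : S) : ℝ :=
  ∑ m ∈ Finset.range M,
      X.c m s * Real.cos (g.ω₀ * t + g.θ₀ - g.ε * (m + 1) + (g.φ m + X.δ m s))
    + ∑ n ∈ Finset.range N, X.b n s * Real.cos (X.ω n s * t + X.θ n s)

/-- Quadrature component. -/
def Ts (X : Randomness S) (g : Config) (t : ℝ) (M N : ℕ) (s : S) : ℝ :=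
  ∑ m ∈ Finset.range M,
      X.c m s * Real.sin (g.ω₀ * t + g.θ₀ - g.ε * (m + 1) + (g.φ m + X.δ m s))
    + ∑ n ∈ Finset.range N, X.b n s * Real.sin (X.ω n s * t + X.θ n s)

/-- Complex envelope `T_c + j T_s`. -/
def complexEnvelope (X : Randomness S) (g : Config) (t : ℝ) (M N : ℕ) (s : S) : ℂ :=
  (Tc X g t M N s : ℂ) + Complex.I * (Ts X g t M N s : ℂ)

/-- `Ξ² = E[T_c]² + E[T_s]²`. -/
def XiSq (X : Randomness S) (μ : Measure S) (g : Config) (t : ℝ) (M N : ℕ) : ℝ :=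
  (∫ s, Tc X g t M N s ∂μ) ^ 2 + (∫ s, Ts X g t M N s ∂μ) ^ 2

/-- `σ = Var T_c + Var T_s`. -/
def sigma (X : Randomness S) (μ : Measure S) (g : Config) (t : ℝ) (M N : ℕ) : ℝ :=
  variance (Tc X g t M N) μ + variance (Ts X g t M N) μ

/-- Effective shape factor `Ξ² / σ`. -/
def KEff (X : Randomness S) (μ : Measure S) (g : Config) (t : ℝ) (M N : ℕ) : ℝ :=
  XiSq X μ g t M N / sigma X μ g t M N

/-- Scale factor `Ξ² + σ`. -/
def scale (X : Randomness S) (μ : Measure S) (g : Config) (t : ℝ) (M N : ℕ) : ℝ :=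
  XiSq X μ g t M N + sigma X μ g t M N

/-- Nakagami shape `(σ + Ξ²)² / ((σ + Ξ²)² - Ξ⁴)`. -/
def mNak (X : Randomness S) (μ : Measure S) (g : Config) (t : ℝ) (M N : ℕ) : ℝ :=
  (sigma X μ g t M N + XiSq X μ g t M N) ^ 2
    / ((sigma X μ g t M N + XiSq X μ g t M N) ^ 2 - XiSq X μ g t M N ^ 2)

/-- In-phase and quadrature components are not both degenerate, have equal variances, and are
uncorrelated. -/
def Balanced (X : Randomness S) (μ : Measure S) (g : Config) (t : ℝ) (M N : ℕ) : Prop :=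
  0 < sigma X μ g t M N ∧
  variance (Tc X g t M N) μ = variance (Ts X g t M N) μ ∧
  covariance (Tc X g t M N) (Ts X g t M N) μ = 0

/-- The distribution function of the envelope `|T_c + j T_s|` differs from that of `ν` by at most `η`
everywhere. -/
def EnvelopeWithin (X : Randomness S) (μ : Measure S) (g : Config) (t : ℝ) (M N : ℕ)
    (ν : Measure ℝ) (η : ℝ) : Prop :=
  ∀ x : ℝ, |μ.real {s | ‖complexEnvelope X g t M N s‖ ≤ x} - ν.real (Iic x)| ≤ η

end RIS

end

/-!
The phasors of the two links are i.i.d. up to deterministic rotations, and a rotation changes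
neither the total variance of a planar vector nor its Lindeberg ratio. A second-order expansion of
characteristic functions therefore gives a central limit theorem, uniform in the deterministic
parameters, for the centred envelope divided by `√σ`. When the components are balanced the limit is
the standard circular Gaussian law, whose annuli have mass at most proportional to their width, so
weak convergence is uniform over all balls, and the modulus of a displaced circular Gaussian
variable is Rician.

The standardised square of a Rician variable is a quadratic form `α Re Z + β (|Z|² - 1)` of a
standard circular Gaussian `Z`, and that of a Nakagami variable is a standardised gamma variable.
As `K → 0` both converge to the centred exponential law, as `K → ∞` both converge to the standard
normal law, and for every `K` both have mean `0` and variance `1`, which matches the second and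
fourth moments. With aligned phases `K` is a fixed multiple of `M`, so it is either zero or tends
to infinity.
-/

namespace RIS

open Filter Topology

section WeakConvergence

variable {E ι : Type*} [MeasurableSpace E] {l : Filter ι}

lemma tendsto_of_tendsto_charFun [NormedAddCommGroup E] [InnerProductSpace ℝ E]
    [FiniteDimensional ℝ E] [BorelSpace E] [l.IsCountablyGenerated]
    {ν : ι → ProbabilityMeasure E} {ν₀ : ProbabilityMeasure E}
    (h : ∀ ξ : E, Tendsto (fun i ↦ charFun (ν i) ξ) l (𝓝 (charFun ν₀ ξ))) :
    Tendsto ν l (𝓝 ν₀) :=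
  tendsto_of_seq_tendsto fun _ hu ↦
    ProbabilityMeasure.tendsto_of_tendsto_charFun fun ξ ↦ (h ξ).comp hu

lemma thickening_sublevel_subset {E : Type*} [PseudoMetricSpace E] {f : E → ℝ}
    (hf : LipschitzWith 1 f) (ε r : ℝ) :
    Metric.thickening ε {x | f x ≤ r} ⊆ {x | f x ≤ r + ε} := by
  intro x hx
  obtain ⟨z, hz, hxz⟩ := Metric.mem_thickening_iff.1 hx
  have hdist : |f x - f z| ≤ dist x z := by simpa [Real.dist_eq] using hf.dist_le_mul x z
  simp only [mem_ofPred_eq] at hz ⊢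
  linarith [le_abs_self (f x - f z)]

variable [PseudoMetricSpace E]

lemma measureReal_le_thickening_add_of_levyProkhorovDist_lt [OpensMeasurableSpace E]
    {ρ τ : Measure E} [IsFiniteMeasure ρ] [IsFiniteMeasure τ] {ε : ℝ}
    (h : levyProkhorovDist ρ τ < ε) {B : Set E} (hB : MeasurableSet B) :
    ρ.real B ≤ τ.real (Metric.thickening ε B) + ε := by
  have hε : 0 ≤ ε := ENNReal.toReal_nonneg.trans h.le
  have hle := ENNReal.toReal_mono (by finiteness) <| left_measure_le_of_levyProkhorovEDist_lt
    ((ENNReal.lt_ofReal_iff_toReal_lt (levyProkhorovEDist_ne_top _ _)).2 h) hB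
  rwa [ENNReal.toReal_add (by finiteness) (by finiteness), ENNReal.toReal_ofReal hε] at hle

variable [BorelSpace E]

lemma measureReal_sublevel_le_add_of_levyProkhorovDist_lt {ρ τ : Measure E}
    [IsFiniteMeasure ρ] [IsFiniteMeasure τ] {ε : ℝ} (h : levyProkhorovDist ρ τ < ε)
    {f : E → ℝ} (hf : LipschitzWith 1 f) (r : ℝ) :
    ρ.real {x | f x ≤ r} ≤ τ.real {x | f x ≤ r + ε} + ε :=
  (measureReal_le_thickening_add_of_levyProkhorovDist_lt h
    (hf.continuous.measurable measurableSet_Iic)).trans <| by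
      gcongr
      · finiteness
      · exact thickening_sublevel_subset hf ε r

lemma abs_measureReal_sublevel_sub_le {ρ τ : Measure E} [IsFiniteMeasure ρ] [IsFiniteMeasure τ]
    {f : E → ℝ} (hf : LipschitzWith 1 f) {ε c : ℝ}
    (hτ : ∀ r, τ.real {x | f x ∈ Ioc r (r + ε)} ≤ c) (h : levyProkhorovDist ρ τ < ε) (r : ℝ) :
    |ρ.real {x | f x ≤ r} - τ.real {x | f x ≤ r}| ≤ c + ε := by
  have hshell : ∀ r, τ.real {x | f x ≤ r + ε} ≤ τ.real {x | f x ≤ r} + c := fun r ↦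
    calc τ.real {x | f x ≤ r + ε}
        ≤ τ.real ({x | f x ≤ r} ∪ {x | f x ∈ Ioc r (r + ε)}) :=
          measureReal_mono fun x hx ↦ (le_or_gt (f x) r).imp id fun hr ↦ ⟨hr, hx⟩
      _ ≤ τ.real {x | f x ≤ r} + τ.real {x | f x ∈ Ioc r (r + ε)} := measureReal_union_le _ _
      _ ≤ τ.real {x | f x ≤ r} + c := by gcongr; exact hτ r
  have hupper := measureReal_sublevel_le_add_of_levyProkhorovDist_lt h hf r
  rw [levyProkhorovDist_comm] at h
  have hlower := measureReal_sublevel_le_add_of_levyProkhorovDist_lt h hf (r - ε)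
  have hshell' := hshell (r - ε)
  rw [sub_add_cancel] at hlower hshell'
  rw [abs_le]
  constructor <;> linarith [hshell r]

lemma eventually_forall_abs_measureReal_sublevel_sub_le [TopologicalSpace.SeparableSpace E]
    {ν : ι → ProbabilityMeasure E} {ν₀ : ProbabilityMeasure E} (h : Tendsto ν l (𝓝 ν₀))
    {κ : Type*} {f : κ → E → ℝ} (hf : ∀ k, LipschitzWith 1 (f k)) {C : ℝ} (hC₀ : 0 ≤ C)
    (hC : ∀ k, ∀ r ε : ℝ, 0 ≤ ε → (ν₀ : Measure E).real {x | f k x ∈ Ioc r (r + ε)} ≤ C * ε)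
    {η : ℝ} (hη : 0 < η) :
    ∀ᶠ i in l, ∀ k r,
      |(ν i : Measure E).real {x | f k x ≤ r} - (ν₀ : Measure E).real {x | f k x ≤ r}| ≤ η := by
  have hε : 0 < η / (C + 1) := by positivity
  have hdist : ∀ᶠ i in l, levyProkhorovDist (ν i : Measure E) ν₀ < η / (C + 1) := by
    simpa only [LevyProkhorov.dist_probabilityMeasure_def, Function.comp_apply] using
      Metric.tendsto_nhds.1
        ((LevyProkhorov.continuous_ofMeasure_probabilityMeasure.tendsto ν₀).comp h) _ hε
  filter_upwards [hdist] with i hi k r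
  calc _ ≤ C * (η / (C + 1)) + η / (C + 1) :=
        abs_measureReal_sublevel_sub_le (hf k) (fun r ↦ hC k r _ hε.le) hi r
    _ = η := by field_simp

lemma eventually_forall_abs_measureReal_Iic_sub_le {ν : ι → ProbabilityMeasure ℝ}
    {ν₀ : ProbabilityMeasure ℝ} (h : Tendsto ν l (𝓝 ν₀)) {C : ℝ} (hC₀ : 0 ≤ C)
    (hC : ∀ r ε : ℝ, 0 ≤ ε → (ν₀ : Measure ℝ).real (Ioc r (r + ε)) ≤ C * ε)
    {η : ℝ} (hη : 0 < η) :
    ∀ᶠ i in l, ∀ r,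
      |(ν i : Measure ℝ).real (Iic r) - (ν₀ : Measure ℝ).real (Iic r)| ≤ η :=
  (eventually_forall_abs_measureReal_sublevel_sub_le h (κ := Unit) (fun _ ↦ LipschitzWith.id)
    hC₀ (fun _ ↦ hC) hη).mono fun _ hi ↦ hi ()

lemma eventually_forall_abs_measureReal_Iic_sub_Iic_le {ν ν' : ι → ProbabilityMeasure ℝ}
    {ν₀ : ProbabilityMeasure ℝ} (h : Tendsto ν l (𝓝 ν₀)) (h' : Tendsto ν' l (𝓝 ν₀)) {C : ℝ}
    (hC₀ : 0 ≤ C) (hC : ∀ r ε : ℝ, 0 ≤ ε → (ν₀ : Measure ℝ).real (Ioc r (r + ε)) ≤ C * ε)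
    {η : ℝ} (hη : 0 < η) :
    ∀ᶠ i in l, ∀ r,
      |(ν i : Measure ℝ).real (Iic r) - (ν' i : Measure ℝ).real (Iic r)| ≤ η := by
  filter_upwards [eventually_forall_abs_measureReal_Iic_sub_le h hC₀ hC (half_pos hη),
    eventually_forall_abs_measureReal_Iic_sub_le h' hC₀ hC (half_pos hη)] with i hi hi' r
  calc _ ≤ _ := abs_sub_le _ ((ν₀ : Measure ℝ).real (Iic r)) _
    _ ≤ η / 2 + η / 2 := add_le_add (hi r) ((abs_sub_comm _ _).trans_le (hi' r))
    _ = η := add_halves η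

end WeakConvergence

section HalfLineDensities

lemma map_withDensity_Ioi {φ φ' : ℝ → ℝ} (hm : Measurable φ)
    (hφ : ∀ x ∈ Ioi (0 : ℝ), HasDerivWithinAt φ (φ' x) (Ioi 0) x)
    (hφ_image : BijOn φ (Ioi 0) (Ioi 0)) (g : ℝ → ENNReal) :
    ((volume.restrict (Ioi 0)).withDensity fun x ↦ ENNReal.ofReal |φ' x| * g (φ x)).map φ =
      (volume.restrict (Ioi 0)).withDensity g := by
  ext s hs
  have hps : MeasurableSet (φ ⁻¹' s) := hm hs
  have himage : s ∩ Ioi 0 = φ '' (φ ⁻¹' s ∩ Ioi 0) := by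
    rw [inter_comm (φ ⁻¹' s), image_inter_preimage, hφ_image.image_eq, inter_comm]
  rw [Measure.map_apply hm hs, withDensity_apply _ hps, withDensity_apply _ hs,
    Measure.restrict_restrict hps, Measure.restrict_restrict hs, himage,
    lintegral_image_eq_lintegral_abs_deriv_mul (hps.inter measurableSet_Ioi)
      (fun x hx ↦ (hφ x hx.2).mono inter_subset_right) (hφ_image.injOn.mono inter_subset_right)]

lemma withDensity_restrict_real_Ioc_le {s : Set ℝ} {p : ℝ → ℝ} {C : ℝ} (hp : ∀ x ∈ s, p x ≤ C)
    (hC : 0 ≤ C) (r : ℝ) {ε : ℝ} (hε : 0 ≤ ε) :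
    ((volume.restrict s).withDensity fun x ↦ ENNReal.ofReal (p x)).real (Ioc r (r + ε)) ≤
      C * ε := by
  refine ENNReal.toReal_le_of_le_ofReal (by positivity) ?_
  rw [withDensity_apply _ measurableSet_Ioc, Measure.restrict_restrict measurableSet_Ioc]
  calc _ ≤ ∫⁻ _ in Ioc r (r + ε) ∩ s, ENNReal.ofReal C :=
        setLIntegral_mono measurable_const fun x hx ↦ ENNReal.ofReal_le_ofReal (hp x hx.2)
    _ ≤ ∫⁻ _ in Ioc r (r + ε), ENNReal.ofReal C := lintegral_mono_set inter_subset_left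
    _ = ENNReal.ofReal (C * ε) := by simp [ENNReal.ofReal_mul hC]

lemma ae_pos_withDensity_Ioi (p : ℝ → ENNReal) :
    ∀ᵐ x ∂(volume.restrict (Ioi 0)).withDensity p, 0 < x :=
  (withDensity_absolutelyContinuous _ _).ae_le (ae_restrict_mem measurableSet_Ioi)

end HalfLineDensities

section ComplexGaussian

lemma map_add_right_withDensity {f : ℂ → ENNReal} (a : ℂ) :
    ((volume : Measure ℂ).withDensity f).map (· + a) =
      volume.withDensity fun z ↦ f (z - a) := by
  ext s hs
  have hps : MeasurableSet ((· + a) ⁻¹' s) := (measurable_add_const a) hs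
  rw [Measure.map_apply (measurable_add_const a) hs, withDensity_apply _ hps,
    withDensity_apply _ hs, ← lintegral_indicator hps, ← lintegral_indicator hs,
    ← lintegral_add_right_eq_self (s.indicator fun z ↦ f (z - a)) a]
  exact lintegral_congr fun z ↦ by simp only [indicator, add_sub_cancel_right]; rfl

lemma map_norm_withDensity {f : ℂ → ENNReal} (hf : Measurable f) :
    ((volume : Measure ℂ).withDensity f).map norm =
      (volume.restrict (Ioi 0)).withDensity fun r ↦ ENNReal.ofReal r *
        ∫⁻ θ in Ioo (-Real.pi) Real.pi, f (Complex.polarCoord.symm (r, θ)) := by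
  have hpolar : Measurable fun p : ℝ × ℝ ↦ (Complex.polarCoord.symm p : ℂ) := by
    simp only [Complex.polarCoord_symm_apply]; fun_prop
  ext s hs
  have hps : MeasurableSet (norm ⁻¹' s : Set ℂ) := measurable_norm hs
  rw [Measure.map_apply measurable_norm hs, withDensity_apply _ hps, withDensity_apply _ hs,
    ← lintegral_indicator hps, ← lintegral_indicator hs, ← Complex.lintegral_comp_polarCoord_symm,
    polarCoord_target, Measure.volume_eq_prod, ← Measure.prod_restrict,
    lintegral_prod _ (by fun_prop (disch := measurability))]
  refine setLIntegral_congr_fun measurableSet_Ioi fun r (hr : 0 < r) ↦ ?_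
  have hmem (θ : ℝ) : (Complex.polarCoord.symm (r, θ) : ℂ) ∈ norm ⁻¹' s ↔ r ∈ s := by
    rw [mem_preimage, Complex.norm_polarCoord_symm, abs_of_pos hr]
  by_cases hrs : r ∈ s
  · simp only [indicator, hmem, hrs, if_true, smul_eq_mul]
    exact lintegral_const_mul _ (by fun_prop)
  · simp only [indicator, hmem, hrs, if_false, smul_zero, lintegral_zero]

/-- The standard circularly symmetric Gaussian law on `ℂ`, normalised to mean square `1`. -/
noncomputable def complexGaussian : Measure ℂ :=
  volume.withDensity fun z ↦ ENNReal.ofReal (Real.pi⁻¹ * Real.exp (-‖z‖ ^ 2))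

instance isProbabilityMeasure_complexGaussian : IsProbabilityMeasure complexGaussian := by
  have hintegral : ∫ z : ℂ, Real.pi⁻¹ * Real.exp (-‖z‖ ^ 2) = 1 := by
    have h := GaussianFourier.integral_rexp_neg_mul_sq_norm (V := ℂ) (b := 1) one_pos
    simp only [neg_mul, one_mul, div_one, Complex.finrank_real_complex, Nat.cast_ofNat,
      div_self (two_ne_zero' ℝ), Real.rpow_one] at h
    rw [integral_const_mul, h, inv_mul_cancel₀ Real.pi_ne_zero]
  refine ⟨?_⟩
  rw [complexGaussian, withDensity_apply _ .univ, setLIntegral_univ,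
    ← ofReal_integral_eq_lintegral_ofReal (.of_integral_ne_zero (by simp [hintegral]))
      (Eventually.of_forall fun z ↦ by positivity), hintegral, ENNReal.ofReal_one]

lemma charFun_complexGaussian (ξ : ℂ) :
    charFun complexGaussian ξ = Complex.exp (-(‖ξ‖ ^ 2 / 4 : ℝ)) := by
  rw [charFun_apply, complexGaussian, integral_withDensity_eq_integral_toReal_smul
    (by fun_prop) (by simp)]
  have hintegrand (z : ℂ) : (ENNReal.ofReal (Real.pi⁻¹ * Real.exp (-‖z‖ ^ 2))).toReal •
      Complex.exp ((inner ℝ z ξ : ℝ) * Complex.I) =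
      (Real.pi : ℂ)⁻¹ * Complex.exp (-1 * (‖z‖ : ℂ) ^ 2 + Complex.I * (inner ℝ ξ z : ℝ)) := by
    rw [ENNReal.toReal_ofReal (by positivity), Complex.exp_add, real_inner_comm,
      Complex.real_smul]
    push_cast
    rw [mul_assoc, mul_comm Complex.I]
    simp
  simp_rw [hintegrand]
  rw [integral_const_mul, GaussianFourier.integral_cexp_neg_mul_sq_norm_add (b := 1) (by simp),
    Complex.finrank_real_complex, Nat.cast_ofNat, div_self two_ne_zero, Complex.cpow_one,
    div_one, inv_mul_cancel_left₀ (by exact_mod_cast Real.pi_ne_zero), Complex.I_sq]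
  congr 1
  push_cast
  ring

end ComplexGaussian

section RicianLaw

lemma integral_exp_mul_cos_sub (z α : ℝ) :
    ∫ θ in Ioo (-Real.pi) Real.pi, Real.exp (z * Real.cos (θ - α)) =
      2 * Real.pi * besselI0 z := by
  have hcont : Continuous fun θ ↦ Real.exp (z * Real.cos θ) := by fun_prop
  have hperiodic : Function.Periodic (fun θ ↦ Real.exp (z * Real.cos θ)) (2 * Real.pi) := by
    intro θ; simp
  have hshift : ∫ θ in (-Real.pi - α)..(Real.pi - α), Real.exp (z * Real.cos θ) =
      ∫ θ in (-Real.pi)..Real.pi, Real.exp (z * Real.cos θ) := by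
    have h := hperiodic.intervalIntegral_add_eq (-Real.pi - α) (-Real.pi)
    rwa [show -Real.pi - α + 2 * Real.pi = Real.pi - α by ring,
      show -Real.pi + 2 * Real.pi = Real.pi by ring] at h
  have heven : ∫ θ in (-Real.pi)..0, Real.exp (z * Real.cos θ) =
      ∫ θ in (0 : ℝ)..Real.pi, Real.exp (z * Real.cos θ) := by
    simpa using (intervalIntegral.integral_comp_neg (a := 0) (b := Real.pi)
      fun θ ↦ Real.exp (z * Real.cos θ)).symm
  rw [← integral_Ioc_eq_integral_Ioo,
    ← intervalIntegral.integral_of_le (by linarith [Real.pi_pos]),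
    intervalIntegral.integral_comp_sub_right (fun θ ↦ Real.exp (z * Real.cos θ)) α, hshift,
    ← intervalIntegral.integral_add_adjacent_intervals
      (hcont.intervalIntegrable (-Real.pi) 0) (hcont.intervalIntegrable 0 Real.pi), heven, besselI0]
  field_simp
  ring

lemma sq_norm_polarCoord_symm_sub (r θ : ℝ) (a : ℂ) :
    ‖(Complex.polarCoord.symm (r, θ) : ℂ) - a‖ ^ 2 =
      r ^ 2 + ‖a‖ ^ 2 - 2 * r * ‖a‖ * Real.cos (θ - a.arg) := by
  have hre : a.re = ‖a‖ * Real.cos a.arg := (Complex.norm_mul_cos_arg a).symm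
  have him : a.im = ‖a‖ * Real.sin a.arg := (Complex.norm_mul_sin_arg a).symm
  rw [Complex.polarCoord_symm_apply, Complex.sq_norm, Complex.normSq_apply]
  simp only [Complex.sub_re, Complex.sub_im, Complex.mul_re, Complex.mul_im, Complex.ofReal_re,
    Complex.ofReal_im, Complex.add_re, Complex.add_im, Complex.I_re, Complex.I_im]
  rw [hre, him, Real.cos_sub]
  linear_combination
    r ^ 2 * Real.sin_sq_add_cos_sq θ + ‖a‖ ^ 2 * Real.sin_sq_add_cos_sq a.arg

lemma ricianPDF_add_one {K : ℝ} (hK : 0 ≤ K) (x : ℝ) :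
    ricianPDF K (K + 1) x = 2 * x * Real.exp (-K - x ^ 2) * besselI0 (2 * x * √K) := by
  have hK1 : K + 1 ≠ 0 := by positivity
  rw [ricianPDF, mul_div_cancel_right₀ _ hK1, mul_div_cancel_left₀ _ hK1,
    mul_div_cancel_right₀ _ hK1]

lemma lintegral_gaussian_circle {r : ℝ} (hr : 0 ≤ r) (a : ℂ) :
    ENNReal.ofReal r * ∫⁻ θ in Ioo (-Real.pi) Real.pi, ENNReal.ofReal
        (Real.pi⁻¹ * Real.exp (-‖(Complex.polarCoord.symm (r, θ) : ℂ) - a‖ ^ 2)) =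
      ENNReal.ofReal (ricianPDF (‖a‖ ^ 2) (‖a‖ ^ 2 + 1) r) := by
  have hintegrand (θ : ℝ) : Real.pi⁻¹ *
      Real.exp (-‖(Complex.polarCoord.symm (r, θ) : ℂ) - a‖ ^ 2) =
      Real.pi⁻¹ * Real.exp (-‖a‖ ^ 2 - r ^ 2) *
        Real.exp (2 * r * ‖a‖ * Real.cos (θ - a.arg)) := by
    rw [mul_assoc, ← Real.exp_add, sq_norm_polarCoord_symm_sub]
    ring_nf
  simp_rw [hintegrand]
  rw [← ofReal_integral_eq_lintegral_ofReal, ← ENNReal.ofReal_mul hr, integral_const_mul,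
    integral_exp_mul_cos_sub, ricianPDF_add_one (by positivity), Real.sqrt_sq (norm_nonneg _)]
  · field_simp
  · exact (Continuous.integrableOn_Icc (by fun_prop)).mono_set Ioo_subset_Icc_self
  · exact Eventually.of_forall fun θ ↦ by positivity

lemma map_norm_add_complexGaussian (a : ℂ) :
    complexGaussian.map (fun z ↦ ‖z + a‖) = ricianMeasure (‖a‖ ^ 2) (‖a‖ ^ 2 + 1) := by
  rw [show (fun z ↦ ‖z + a‖) = norm ∘ (· + a) from rfl,
    ← Measure.map_map measurable_norm (measurable_add_const a), complexGaussian,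
    map_add_right_withDensity, map_norm_withDensity (by fun_prop), ricianMeasure]
  refine withDensity_congr_ae ?_
  filter_upwards [ae_restrict_mem measurableSet_Ioi] with r hr
  exact lintegral_gaussian_circle (le_of_lt hr) a

lemma ricianPDF_scale {K c : ℝ} (hK : 0 ≤ K) (hc : 0 < c) (x : ℝ) :
    c * ricianPDF K (c ^ 2 * (K + 1)) (c * x) = ricianPDF K (K + 1) x := by
  have hK1 : K + 1 ≠ 0 := by positivity
  have hexp : (K + 1) * (c * x) ^ 2 / (c ^ 2 * (K + 1)) = x ^ 2 := by field_simp
  have hsqrt : √(K * (K + 1) / (c ^ 2 * (K + 1))) = √K / c := by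
    rw [mul_div_mul_right _ _ hK1, Real.sqrt_div hK, Real.sqrt_sq hc.le]
  have harg : 2 * (c * x) * (√K / c) = 2 * x * √K := by field_simp
  rw [ricianPDF_add_one hK, ricianPDF, hexp, hsqrt, harg]
  field_simp

lemma map_mul_ricianMeasure {K c : ℝ} (hK : 0 ≤ K) (hc : 0 < c) :
    (ricianMeasure K (K + 1)).map (c * ·) = ricianMeasure K (c ^ 2 * (K + 1)) := by
  have hbij : BijOn (c * ·) (Ioi 0) (Ioi 0) :=
    ⟨fun _ hx ↦ mul_pos hc hx, (mul_right_injective₀ hc.ne').injOn, by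
      rw [SurjOn, image_mul_left_Ioi hc, mul_zero]⟩
  have h := map_withDensity_Ioi (φ' := fun _ ↦ c) (measurable_const_mul c)
    (fun x _ ↦ (hasDerivAt_const_mul c).hasDerivWithinAt) hbij
    fun x ↦ ENNReal.ofReal (ricianPDF K (c ^ 2 * (K + 1)) x)
  simp only [abs_of_pos hc, ← ENNReal.ofReal_mul hc.le, ricianPDF_scale hK hc] at h
  exact h

lemma map_norm_sqrt_mul_add_complexGaussian {σ : ℝ} (hσ : 0 < σ) (b : ℂ) :
    complexGaussian.map (fun z ↦ ‖(√σ : ℂ) * z + b‖) =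
      ricianMeasure (‖b‖ ^ 2 / σ) (‖b‖ ^ 2 + σ) := by
  have hs : 0 < √σ := Real.sqrt_pos.2 hσ
  have hs' : (√σ : ℂ) ≠ 0 := by exact_mod_cast hs.ne'
  have hnorm : ‖(√σ : ℂ)‖ = √σ := by rw [Complex.norm_real, Real.norm_of_nonneg hs.le]
  have hK : ‖b / (√σ : ℂ)‖ ^ 2 = ‖b‖ ^ 2 / σ := by
    rw [norm_div, div_pow, hnorm, Real.sq_sqrt hσ.le]
  have hfactor (z : ℂ) : ‖(√σ : ℂ) * z + b‖ = √σ * ‖z + b / √σ‖ := by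
    rw [show (√σ : ℂ) * z + b = √σ * (z + b / √σ) by field_simp, norm_mul, hnorm]
  have hΩ : σ * (‖b‖ ^ 2 / σ + 1) = ‖b‖ ^ 2 + σ := by field_simp
  calc complexGaussian.map (fun z ↦ ‖(√σ : ℂ) * z + b‖)
      = (complexGaussian.map fun z ↦ ‖z + b / √σ‖).map (√σ * ·) := by
        simp_rw [hfactor]
        rw [Measure.map_map (by fun_prop) (by fun_prop), Function.comp_def]
    _ = ricianMeasure (‖b‖ ^ 2 / σ) (‖b‖ ^ 2 + σ) := by
        rw [map_norm_add_complexGaussian, hK, map_mul_ricianMeasure (by positivity) hs,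
          Real.sq_sqrt hσ.le, hΩ]

end RicianLaw

section RicianDensityBound

lemma besselI0_le_exp {z : ℝ} (hz : 0 ≤ z) : besselI0 z ≤ Real.exp z := by
  have hmono : ∫ u in (0 : ℝ)..Real.pi, Real.exp (z * Real.cos u) ≤
      ∫ _ in (0 : ℝ)..Real.pi, Real.exp z :=
    intervalIntegral.integral_mono_on Real.pi_pos.le
      (Continuous.intervalIntegrable (by fun_prop) _ _) (by simp)
      fun u _ ↦ Real.exp_le_exp.2 (mul_le_of_le_one_right hz (Real.cos_le_one u))
  calc besselI0 z ≤ Real.pi⁻¹ * ∫ _ in (0 : ℝ)..Real.pi, Real.exp z := by rw [besselI0]; gcongr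
    _ = Real.exp z := by simp [Real.pi_ne_zero]

lemma integral_exp_neg_mul_sq_le {b : ℝ} (hb : 0 < b) {x : ℝ} (hx : 0 ≤ x) :
    ∫ u in (0 : ℝ)..x, Real.exp (-b * u ^ 2) ≤ √(Real.pi / b) / 2 := by
  rw [intervalIntegral.integral_of_le hx, ← integral_gaussian_Ioi]
  exact setIntegral_mono_set (integrable_exp_neg_mul_sq hb).integrableOn
    (Eventually.of_forall fun _ ↦ (Real.exp_pos _).le) Ioc_subset_Ioi_self.eventuallyLE

lemma besselI0_le_exp_mul_sqrt {z : ℝ} (hz : 0 < z) :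
    besselI0 z ≤ Real.exp z * (√(Real.pi / (2 * z)) / 2) := by
  have hpi := Real.pi_pos
  have hquadratic {u : ℝ} (hu : u ∈ Icc 0 Real.pi) :
      Real.exp (z * Real.cos u) ≤ Real.exp z * Real.exp (-(2 * z / Real.pi ^ 2) * u ^ 2) := by
    rw [← Real.exp_add]
    refine Real.exp_le_exp.2 ?_
    calc z * Real.cos u ≤ z * (1 - 2 / Real.pi ^ 2 * u ^ 2) := by
          gcongr
          exact Real.cos_le_one_sub_mul_cos_sq (by rw [abs_of_nonneg hu.1]; exact hu.2)
      _ = z + -(2 * z / Real.pi ^ 2) * u ^ 2 := by ring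
  have hsqrt : √(Real.pi / (2 * z / Real.pi ^ 2)) = Real.pi * √(Real.pi / (2 * z)) := by
    rw [show Real.pi / (2 * z / Real.pi ^ 2) = Real.pi ^ 2 * (Real.pi / (2 * z)) by field_simp,
      Real.sqrt_mul (by positivity), Real.sqrt_sq hpi.le]
  calc besselI0 z
      ≤ Real.pi⁻¹ * ∫ u in (0 : ℝ)..Real.pi,
          Real.exp z * Real.exp (-(2 * z / Real.pi ^ 2) * u ^ 2) := by
        rw [besselI0]
        gcongr
        exact intervalIntegral.integral_mono_on hpi.le
          (Continuous.intervalIntegrable (by fun_prop) _ _)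
          (Continuous.intervalIntegrable (by fun_prop) _ _) fun u hu ↦ hquadratic hu
    _ ≤ Real.pi⁻¹ * (Real.exp z * (Real.pi * √(Real.pi / (2 * z)) / 2)) := by
        rw [intervalIntegral.integral_const_mul, ← hsqrt]
        gcongr
        exact integral_exp_neg_mul_sq_le (by positivity) hpi.le
    _ = Real.exp z * (√(Real.pi / (2 * z)) / 2) := by field_simp

lemma ricianPDF_le_of_sqrt_le {K x : ℝ} (hK : 0 ≤ K) (hx : 0 ≤ x) (h : √K ≤ x / 2) :
    ricianPDF K (K + 1) x ≤ 2 := by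
  have hle : x ≤ Real.exp ((x - √K) ^ 2) := by
    nlinarith [Real.add_one_le_exp ((x - √K) ^ 2), sq_nonneg (x / 2 - 1), Real.sqrt_nonneg K]
  calc ricianPDF K (K + 1) x
      ≤ 2 * x * Real.exp (-K - x ^ 2) * Real.exp (2 * x * √K) := by
        rw [ricianPDF_add_one hK]
        gcongr
        exact besselI0_le_exp (by positivity)
    _ = 2 * (x * Real.exp (-(x - √K) ^ 2)) := by
        rw [mul_assoc, ← Real.exp_add, mul_assoc]
        congr 3
        linear_combination Real.sq_sqrt hK
    _ ≤ 2 * (Real.exp ((x - √K) ^ 2) * Real.exp (-(x - √K) ^ 2)) := by gcongr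
    _ = 2 := by rw [← Real.exp_add, add_neg_cancel, Real.exp_zero, mul_one]

lemma ricianPDF_le_of_le_sqrt {K x : ℝ} (hK : 0 ≤ K) (hx : 0 < x) (h : x / 2 ≤ √K) :
    ricianPDF K (K + 1) x ≤ 2 := by
  have hk : 0 < √K := by linarith
  have hsqrt : √(Real.pi / (2 * (2 * x * √K))) ≤ 2 / x := by
    refine Real.sqrt_le_iff.2 ⟨by positivity, ?_⟩
    rw [div_pow, div_le_div_iff₀ (by positivity) (by positivity)]
    have hsq : x ^ 2 ≤ 2 * x * √K := by nlinarith
    calc Real.pi * x ^ 2 ≤ 4 * (2 * x * √K) := by gcongr; exact Real.pi_le_four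
      _ ≤ 2 ^ 2 * (2 * (2 * x * √K)) := by nlinarith [mul_pos hx hk]
  calc ricianPDF K (K + 1) x
      ≤ 2 * x * Real.exp (-K - x ^ 2) * (Real.exp (2 * x * √K) * (2 / x / 2)) := by
        rw [ricianPDF_add_one hK]
        gcongr
        exact (besselI0_le_exp_mul_sqrt (by positivity)).trans (by gcongr)
    _ = 2 * Real.exp (-(x - √K) ^ 2) := by
        rw [show -(x - √K) ^ 2 = -K - x ^ 2 + 2 * x * √K by linear_combination -Real.sq_sqrt hK,
          Real.exp_add]
        field_simp
    _ ≤ 2 := by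
        have : Real.exp (-(x - √K) ^ 2) ≤ 1 := Real.exp_le_one_iff.2 (neg_nonpos.2 (sq_nonneg _))
        linarith

lemma ricianPDF_le_two {K x : ℝ} (hK : 0 ≤ K) (hx : 0 < x) : ricianPDF K (K + 1) x ≤ 2 :=
  (le_total √K (x / 2)).elim (ricianPDF_le_of_sqrt_le hK hx.le) (ricianPDF_le_of_le_sqrt hK hx)

lemma complexGaussian_real_annulus_le (a : ℂ) (r : ℝ) {ε : ℝ} (hε : 0 ≤ ε) :
    complexGaussian.real {z | ‖z + a‖ ∈ Ioc r (r + ε)} ≤ 2 * ε := by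
  have hmap : complexGaussian.real {z | ‖z + a‖ ∈ Ioc r (r + ε)} =
      (complexGaussian.map fun z ↦ ‖z + a‖).real (Ioc r (r + ε)) :=
    (map_measureReal_apply (by fun_prop) measurableSet_Ioc).symm
  rw [hmap, map_norm_add_complexGaussian]
  exact withDensity_restrict_real_Ioc_le (fun x hx ↦ ricianPDF_le_two (by positivity) hx)
    zero_le_two r hε

end RicianDensityBound

section GaussianDefect

lemma norm_cexp_mul_I_sub_taylor_le (x : ℝ) :
    ‖Complex.exp (x * Complex.I) - (1 + x * Complex.I - x ^ 2 / 2)‖ ≤ 4 * (x ^ 2 * min 1 |x|) := by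
  have hnorm : ‖(x : ℂ) * Complex.I‖ = |x| := by simp
  rcases le_or_gt |x| 1 with h | h
  · have htaylor := Complex.exp_bound (hnorm.trans_le h) (n := 3) (by norm_num)
    have hsum : ∑ m ∈ Finset.range 3, (x * Complex.I) ^ m / (m.factorial : ℂ) =
        1 + x * Complex.I - x ^ 2 / 2 := by
      simp only [Finset.sum_range_succ, Finset.range_zero, Finset.sum_empty, mul_pow, Complex.I_sq,
        Nat.factorial]
      push_cast
      ring
    rw [hsum, hnorm] at htaylor
    have hcube : x ^ 2 * |x| = |x| ^ 3 := by rw [← sq_abs x]; ring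
    rw [min_eq_right h, hcube]
    refine htaylor.trans ?_
    rw [mul_comm]
    gcongr
    norm_num [Nat.factorial]
  · rw [min_eq_left h.le, mul_one, ← sq_abs x]
    calc ‖Complex.exp (x * Complex.I) - (1 + x * Complex.I - x ^ 2 / 2)‖
        ≤ ‖Complex.exp (x * Complex.I)‖ +
            (‖(1 : ℂ)‖ + ‖(x : ℂ) * Complex.I‖ + ‖(x : ℂ) ^ 2 / 2‖) :=
          (norm_sub_le _ _).trans (by
            gcongr
            exact (norm_sub_le _ _).trans (by gcongr; exact norm_add_le _ _))
      _ = 1 + (1 + |x| + |x| ^ 2 / 2) := by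
          rw [Complex.norm_exp_ofReal_mul_I, hnorm, norm_one]
          simp
      _ ≤ 4 * |x| ^ 2 := by nlinarith

lemma abs_one_sub_sub_exp_neg_le {q : ℝ} (hq : 0 ≤ q) : |1 - q - Real.exp (-q)| ≤ q ^ 2 := by
  rw [abs_sub_comm]
  rcases le_or_gt q 1 with h | h
  · have := Real.abs_exp_sub_one_sub_id_le (x := -q) (by rwa [abs_neg, abs_of_nonneg hq])
    rw [neg_sq] at this
    convert this using 2
    ring
  · have hle := Real.exp_le_one_iff.2 (neg_nonpos.2 hq)
    have hge := Real.add_one_le_exp (-q)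
    rw [abs_of_nonneg (by linarith)]
    nlinarith

lemma norm_mul_sub_mul_le {R : Type*} [SeminormedRing R] {a b c d : R} (ha : ‖a‖ ≤ 1)
    (hd : ‖d‖ ≤ 1) : ‖a * b - c * d‖ ≤ ‖a - c‖ + ‖b - d‖ :=
  calc ‖a * b - c * d‖ = ‖(a - c) * d + a * (b - d)‖ := by congr 1; noncomm_ring
    _ ≤ ‖a - c‖ * ‖d‖ + ‖a‖ * ‖b - d‖ :=
        (norm_add_le _ _).trans (add_le_add (norm_mul_le _ _) (norm_mul_le _ _))
    _ ≤ ‖a - c‖ * 1 + 1 * ‖b - d‖ := by gcongr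
    _ = ‖a - c‖ + ‖b - d‖ := by ring

/-- Distance, at frequency one, between the characteristic function of the centred variable
`X - E[X]` and that of the centred Gaussian law with the same variance. It measures how far `X` is
from Gaussian and is subadditive over independent summands. -/
noncomputable def gaussianDefect {S : Type*} [MeasurableSpace S] (μ : Measure S) (X : S → ℝ) : ℝ :=
  ‖∫ s, Complex.exp ((X s - μ[X] : ℝ) * Complex.I) ∂μ - Complex.exp (-(variance X μ / 2) : ℝ)‖

variable {S : Type*} [MeasurableSpace S] {μ : Measure S} [IsProbabilityMeasure μ] {X Y : S → ℝ}

lemma integral_taylor_cexp_mul_I (hX : MemLp X 2 μ) (h0 : μ[X] = 0) :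
    ∫ s, (1 + (X s : ℂ) * Complex.I - (X s : ℂ) ^ 2 / 2) ∂μ =
      ((1 - variance X μ / 2 : ℝ) : ℂ) := by
  have hint : Integrable (fun s ↦ (X s : ℂ) * Complex.I) μ :=
    (hX.integrable one_le_two).ofReal.mul_const _
  have hint_add : Integrable (fun s ↦ 1 + (X s : ℂ) * Complex.I) μ := (integrable_const _).add hint
  have hint_sq : Integrable (fun s ↦ (X s : ℂ) ^ 2 / 2) μ := by
    simpa using (hX.integrable_sq.ofReal (𝕜 := ℂ)).div_const 2
  have hsq : ∫ s, (X s : ℂ) ^ 2 ∂μ = (variance X μ : ℂ) := by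
    rw [variance_of_integral_eq_zero hX.aestronglyMeasurable.aemeasurable h0,
      ← integral_complex_ofReal]
    simp
  rw [integral_sub hint_add hint_sq, integral_add (integrable_const _) hint,
    integral_mul_const, integral_div, integral_complex_ofReal, h0, hsq]
  simp

lemma gaussianDefect_le_of_integral_eq_zero (hX : MemLp X 2 μ) (h0 : μ[X] = 0) :
    gaussianDefect μ X ≤ 4 * ∫ s, X s ^ 2 * min 1 |X s| ∂μ + variance X μ ^ 2 := by
  have hXm := hX.aestronglyMeasurable.aemeasurable
  have hmin : Integrable (fun s ↦ X s ^ 2 * min 1 |X s|) μ := by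
    refine hX.integrable_sq.mono (by fun_prop) (Eventually.of_forall fun s ↦ ?_)
    rw [Real.norm_of_nonneg (by positivity), Real.norm_of_nonneg (by positivity)]
    exact mul_le_of_le_one_right (by positivity) (min_le_left _ _)
  have hexp : Integrable (fun s ↦ Complex.exp (X s * Complex.I)) μ :=
    .of_bound (by fun_prop) 1 (Eventually.of_forall fun s ↦ (Complex.norm_exp_ofReal_mul_I _).le)
  have htaylor : Integrable (fun s ↦ 1 + (X s : ℂ) * Complex.I - (X s : ℂ) ^ 2 / 2) μ :=
    ((integrable_const _).add ((hX.integrable one_le_two).ofReal.mul_const _)).sub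
      (by simpa using (hX.integrable_sq.ofReal (𝕜 := ℂ)).div_const 2)
  have hcharFun : ‖∫ s, Complex.exp (X s * Complex.I) ∂μ - ((1 - variance X μ / 2 : ℝ) : ℂ)‖ ≤
      4 * ∫ s, X s ^ 2 * min 1 |X s| ∂μ := by
    rw [← integral_taylor_cexp_mul_I hX h0, ← integral_sub hexp htaylor, ← integral_const_mul]
    exact norm_integral_le_of_norm_le (hmin.const_mul 4)
      (Eventually.of_forall fun s ↦ norm_cexp_mul_I_sub_taylor_le (X s))
  have hgaussian : ‖((1 - variance X μ / 2 : ℝ) : ℂ) - Complex.exp (-(variance X μ / 2) : ℝ)‖ ≤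
      variance X μ ^ 2 := by
    have hv := variance_nonneg X μ
    rw [← Complex.ofReal_exp, ← Complex.ofReal_sub, Complex.norm_real, Real.norm_eq_abs]
    exact (abs_one_sub_sub_exp_neg_le (by positivity)).trans (by nlinarith)
  simp only [gaussianDefect, h0, sub_zero]
  exact (norm_sub_le_norm_sub_add_norm_sub _ _ _).trans (add_le_add hcharFun hgaussian)

lemma gaussianDefect_sub_const (hX : Integrable X μ) (c : ℝ) :
    gaussianDefect μ (fun s ↦ X s - c) = gaussianDefect μ X := by
  simp only [gaussianDefect, integral_sub hX (integrable_const c), integral_const, probReal_univ,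
    smul_eq_mul, one_mul, sub_sub_sub_cancel_right]
  rw [variance_sub_const hX.aestronglyMeasurable]

lemma gaussianDefect_zero : gaussianDefect μ (0 : S → ℝ) = 0 := by
  simp [gaussianDefect]

lemma gaussianDefect_add_le (hX : MemLp X 2 μ) (hY : MemLp Y 2 μ) (hXY : IndepFun X Y μ) :
    gaussianDefect μ (X + Y) ≤ gaussianDefect μ X + gaussianDefect μ Y := by
  have hmean : ∫ s, (X s + Y s) ∂μ = μ[X] + μ[Y] :=
    integral_add (hX.integrable one_le_two) (hY.integrable one_le_two)
  have hchar : ∫ s, Complex.exp (((X + Y) s - μ[X + Y] : ℝ) * Complex.I) ∂μ =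
      (∫ s, Complex.exp ((X s - μ[X] : ℝ) * Complex.I) ∂μ) *
        ∫ s, Complex.exp ((Y s - μ[Y] : ℝ) * Complex.I) ∂μ := by
    rw [← hXY.integral_fun_comp_mul_comp
      (f := fun x : ℝ ↦ Complex.exp ((x - μ[X] : ℝ) * Complex.I))
      (g := fun y : ℝ ↦ Complex.exp ((y - μ[Y] : ℝ) * Complex.I))
      hX.aestronglyMeasurable.aemeasurable hY.aestronglyMeasurable.aemeasurable
      (Continuous.aestronglyMeasurable (by fun_prop))
      (Continuous.aestronglyMeasurable (by fun_prop))]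
    refine integral_congr_ae (Eventually.of_forall fun s ↦ ?_)
    simp only [Pi.add_apply, hmean, ← Complex.exp_add]
    congr 1
    push_cast
    ring
  have hgaussian : Complex.exp (-(variance (X + Y) μ / 2) : ℝ) =
      Complex.exp (-(variance X μ / 2) : ℝ) * Complex.exp (-(variance Y μ / 2) : ℝ) := by
    rw [hXY.variance_add hX hY, ← Complex.exp_add]
    congr 1
    push_cast
    ring
  rw [gaussianDefect, hchar, hgaussian]
  refine norm_mul_sub_mul_le ?_ ?_
  · refine (norm_integral_le_of_norm_le_const (C := 1)
      (Eventually.of_forall fun s ↦ (Complex.norm_exp_ofReal_mul_I _).le)).trans ?_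
    simp
  · rw [← Complex.ofReal_exp, Complex.norm_real, Real.norm_of_nonneg (Real.exp_pos _).le,
      Real.exp_le_one_iff]
    linarith [variance_nonneg Y μ]

lemma gaussianDefect_sum_le {ι : Type*} {X : ι → S → ℝ} (hX : ∀ i, MemLp (X i) 2 μ)
    (hind : iIndepFun X μ) (s : Finset ι) :
    gaussianDefect μ (∑ i ∈ s, X i) ≤ ∑ i ∈ s, gaussianDefect μ (X i) := by
  classical
  induction s using Finset.induction_on with
  | empty => simp only [Finset.sum_empty, gaussianDefect_zero, le_refl]
  | insert i s hi ih =>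
    rw [Finset.sum_insert hi, Finset.sum_insert hi]
    refine (gaussianDefect_add_le (hX i) (memLp_finsetSum' s fun j _ ↦ hX j) ?_).trans (by gcongr)
    exact (hind.indepFun_finsetSum_of_notMem₀
      (fun j ↦ (hX j).aestronglyMeasurable.aemeasurable) hi).symm

end GaussianDefect

section Lindeberg

variable {S E : Type*} [MeasurableSpace S] {μ : Measure S} [NormedAddCommGroup E]

/-- Variance of a vector-valued random variable, i.e. the trace of its covariance. -/
noncomputable def totalVariance [NormedSpace ℝ E] (μ : Measure S) (Z : S → E) : ℝ :=
  ∫ s, ‖Z s - μ[Z]‖ ^ 2 ∂μ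

/-- Contribution of large deviations to `totalVariance`, with the smooth truncation
`min 1 (r ‖Z - E[Z]‖)` in place of the indicator in Lindeberg's condition. -/
noncomputable def truncatedVariance [NormedSpace ℝ E] (μ : Measure S) (Z : S → E) (r : ℝ) : ℝ :=
  ∫ s, ‖Z s - μ[Z]‖ ^ 2 * min 1 (r * ‖Z s - μ[Z]‖) ∂μ

/-- Error of the second order expansion of the characteristic function of `Z` at frequencies of norm
`r`, per unit of frequency squared and of variance; `0` when `Z` is almost surely constant. -/
noncomputable def lindebergRatio [NormedSpace ℝ E] (μ : Measure S) (Z : S → E) (r : ℝ) : ℝ :=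
  (4 * truncatedVariance μ Z r + r ^ 2 * totalVariance μ Z ^ 2) / totalVariance μ Z

lemma integrable_sq_norm_sub_const [IsFiniteMeasure μ] {Z : S → E} (hZ : MemLp Z 2 μ) (c : E) :
    Integrable (fun s ↦ ‖Z s - c‖ ^ 2) μ :=
  (hZ.sub (memLp_const c)).norm.integrable_sq

section NormedSpace

variable [NormedSpace ℝ E] {Z : S → E}

lemma totalVariance_nonneg : 0 ≤ totalVariance μ Z := integral_nonneg fun _ ↦ by positivity

lemma lindebergRatio_nonneg {r : ℝ} (hr : 0 ≤ r) : 0 ≤ lindebergRatio μ Z r :=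
  have : 0 ≤ truncatedVariance μ Z r := integral_nonneg fun _ ↦ by positivity
  have : 0 ≤ totalVariance μ Z := totalVariance_nonneg
  by unfold lindebergRatio; positivity

lemma identDistrib_norm_linearIsometry_sub_integral {S' F : Type*} [MeasurableSpace S']
    {ν : Measure S'} [NormedAddCommGroup F] [NormedSpace ℝ F] [CompleteSpace E] [CompleteSpace F]
    [MeasurableSpace E] [BorelSpace E] {W : S' → E} (h : IdentDistrib Z W μ ν) (L : E →ₗᵢ[ℝ] F) :
    IdentDistrib (fun s ↦ ‖L (Z s) - ∫ s, L (Z s) ∂μ‖) (fun s ↦ ‖W s - ν[W]‖) μ ν := by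
  simp only [L.integral_comp_comm, ← map_sub, L.norm_map, h.integral_eq]
  exact h.comp (u := fun z ↦ ‖z - ν[W]‖) (by fun_prop)

lemma totalVariance_linearIsometry_comp {S' F : Type*} [MeasurableSpace S']
    {ν : Measure S'} [NormedAddCommGroup F] [NormedSpace ℝ F] [CompleteSpace E] [CompleteSpace F]
    [MeasurableSpace E] [BorelSpace E] {W : S' → E} (h : IdentDistrib Z W μ ν) (L : E →ₗᵢ[ℝ] F) :
    totalVariance μ (fun s ↦ L (Z s)) = totalVariance ν W :=
  ((identDistrib_norm_linearIsometry_sub_integral h L).comp (u := fun x ↦ x ^ 2)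
    (by fun_prop)).integral_eq

lemma lindebergRatio_linearIsometry_comp {S' F : Type*} [MeasurableSpace S']
    {ν : Measure S'} [NormedAddCommGroup F] [NormedSpace ℝ F] [CompleteSpace E] [CompleteSpace F]
    [MeasurableSpace E] [BorelSpace E] {W : S' → E} (h : IdentDistrib Z W μ ν) (L : E →ₗᵢ[ℝ] F)
    (r : ℝ) : lindebergRatio μ (fun s ↦ L (Z s)) r = lindebergRatio ν W r := by
  have htrunc : truncatedVariance μ (fun s ↦ L (Z s)) r = truncatedVariance ν W r :=
    ((identDistrib_norm_linearIsometry_sub_integral h L).comp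
      (u := fun x ↦ x ^ 2 * min 1 (r * x)) (by fun_prop)).integral_eq
  rw [lindebergRatio, lindebergRatio, htrunc, totalVariance_linearIsometry_comp h]

variable [IsProbabilityMeasure μ]

lemma truncatedVariance_eq_zero (hZ : MemLp Z 2 μ) (h : totalVariance μ Z = 0) (r : ℝ) :
    truncatedVariance μ Z r = 0 := by
  rw [totalVariance, integral_eq_zero_iff_of_nonneg (fun _ ↦ by positivity)
    (integrable_sq_norm_sub_const hZ _)] at h
  refine integral_eq_zero_of_ae ?_
  filter_upwards [h] with s hs
  simp only [Pi.zero_apply] at hs ⊢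
  rw [hs, zero_mul]

lemma totalVariance_mul_lindebergRatio (hZ : MemLp Z 2 μ) (r : ℝ) :
    totalVariance μ Z * lindebergRatio μ Z r =
      4 * truncatedVariance μ Z r + r ^ 2 * totalVariance μ Z ^ 2 :=
  mul_div_cancel_of_imp' fun h ↦ by rw [truncatedVariance_eq_zero hZ h, h]; ring

lemma tendsto_truncatedVariance (hZ : MemLp Z 2 μ) :
    Tendsto (truncatedVariance μ Z) (𝓝[≥] 0) (𝓝 0) := by
  have hm := hZ.aestronglyMeasurable
  suffices h : Tendsto (truncatedVariance μ Z) (𝓝[≥] 0)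
      (𝓝 (∫ s, ‖Z s - μ[Z]‖ ^ 2 * min 1 (0 * ‖Z s - μ[Z]‖) ∂μ)) by simpa using h
  refine tendsto_integral_filter_of_dominated_convergence (fun s ↦ ‖Z s - μ[Z]‖ ^ 2)
    (Eventually.of_forall fun r ↦ by fun_prop) ?_ (integrable_sq_norm_sub_const hZ _) ?_
  · filter_upwards [self_mem_nhdsWithin] with r (hr : 0 ≤ r)
    refine Eventually.of_forall fun s ↦ ?_
    rw [Real.norm_of_nonneg (by positivity)]
    exact mul_le_of_le_one_right (by positivity) (min_le_left _ _)
  · refine Eventually.of_forall fun s ↦ ?_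
    have hcont : Continuous fun r : ℝ ↦ ‖Z s - μ[Z]‖ ^ 2 * min 1 (r * ‖Z s - μ[Z]‖) := by fun_prop
    exact (hcont.tendsto 0).mono_left nhdsWithin_le_nhds

lemma tendsto_lindebergRatio (hZ : MemLp Z 2 μ) :
    Tendsto (lindebergRatio μ Z) (𝓝[≥] 0) (𝓝 0) := by
  have hsq : Tendsto (fun r : ℝ ↦ r ^ 2 * totalVariance μ Z ^ 2) (𝓝[≥] 0) (𝓝 0) :=
    ((by fun_prop : Continuous fun r : ℝ ↦ r ^ 2 * totalVariance μ Z ^ 2).tendsto' 0 0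
      (by simp)).mono_left nhdsWithin_le_nhds
  unfold lindebergRatio
  simpa using (((tendsto_truncatedVariance hZ).const_mul 4).add hsq).div_const (totalVariance μ Z)

end NormedSpace

variable [InnerProductSpace ℝ E] [IsProbabilityMeasure μ]

lemma integral_sq_inner_mul_min_le {Z : S → E} (hZ : MemLp Z 2 μ) (ξ : E) :
    ∫ s, (inner ℝ ξ (Z s - μ[Z])) ^ 2 * min 1 |inner ℝ ξ (Z s - μ[Z])| ∂μ ≤
      ‖ξ‖ ^ 2 * truncatedVariance μ Z ‖ξ‖ := by
  have hm := hZ.aestronglyMeasurable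
  rw [truncatedVariance, ← integral_const_mul]
  refine integral_mono_of_nonneg (Eventually.of_forall fun s ↦ by positivity) ?_
    (Eventually.of_forall fun s ↦ ?_)
  · refine ((integrable_sq_norm_sub_const hZ μ[Z]).const_mul (‖ξ‖ ^ 2)).mono (by fun_prop)
      (Eventually.of_forall fun s ↦ ?_)
    rw [Real.norm_of_nonneg (by positivity), Real.norm_of_nonneg (by positivity), ← mul_assoc]
    exact mul_le_of_le_one_right (by positivity) (min_le_left _ _)
  · have hcs := abs_real_inner_le_norm ξ (Z s - μ[Z])
    simp only
    rw [← mul_assoc, ← mul_pow, ← sq_abs]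
    gcongr

variable [CompleteSpace E]

lemma variance_inner_le {Z : S → E} (hZ : MemLp Z 2 μ) (ξ : E) :
    variance (fun s ↦ inner ℝ ξ (Z s)) μ ≤ ‖ξ‖ ^ 2 * totalVariance μ Z := by
  have hint := hZ.integrable one_le_two
  rw [variance_eq_integral (hZ.const_inner ξ).aestronglyMeasurable.aemeasurable, totalVariance,
    ← integral_const_mul, integral_inner hint]
  simp only [← inner_sub_right]
  have hZ' : MemLp (fun s ↦ Z s - μ[Z]) 2 μ := hZ.sub (memLp_const _)
  refine integral_mono (hZ'.const_inner ξ).integrable_sq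
    ((integrable_sq_norm_sub_const hZ _).const_mul _) fun s ↦ ?_
  simp only
  rw [← mul_pow, ← sq_abs]
  gcongr
  exact abs_real_inner_le_norm _ _

lemma gaussianDefect_inner_le {Z : S → E} (hZ : MemLp Z 2 μ) (ξ : E) :
    gaussianDefect μ (fun s ↦ inner ℝ ξ (Z s)) ≤
      ‖ξ‖ ^ 2 * (totalVariance μ Z * lindebergRatio μ Z ‖ξ‖) := by
  have hint := hZ.integrable one_le_two
  have hZ' : MemLp (fun s ↦ Z s - μ[Z]) 2 μ := hZ.sub (memLp_const _)
  have hzero : ∫ s, inner ℝ ξ (Z s - μ[Z]) ∂μ = 0 := by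
    rw [integral_inner (hZ'.integrable one_le_two), integral_sub hint (integrable_const _)]
    simp
  have hcentre : (fun s ↦ inner ℝ ξ (Z s - μ[Z])) =
      fun s ↦ inner ℝ ξ (Z s) - inner ℝ ξ μ[Z] := by
    ext s; rw [inner_sub_right]
  have hvar : variance (fun s ↦ inner ℝ ξ (Z s - μ[Z])) μ ≤ ‖ξ‖ ^ 2 * totalVariance μ Z := by
    rw [hcentre, variance_sub_const (hZ.const_inner ξ).aestronglyMeasurable]
    exact variance_inner_le hZ ξ
  calc gaussianDefect μ (fun s ↦ inner ℝ ξ (Z s))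
      = gaussianDefect μ (fun s ↦ inner ℝ ξ (Z s - μ[Z])) := by
        rw [hcentre, gaussianDefect_sub_const (hint.const_inner ξ)]
    _ ≤ 4 * ∫ s, (inner ℝ ξ (Z s - μ[Z])) ^ 2 * min 1 |inner ℝ ξ (Z s - μ[Z])| ∂μ +
          variance (fun s ↦ inner ℝ ξ (Z s - μ[Z])) μ ^ 2 :=
        gaussianDefect_le_of_integral_eq_zero (hZ'.const_inner ξ) hzero
    _ ≤ 4 * (‖ξ‖ ^ 2 * truncatedVariance μ Z ‖ξ‖) + (‖ξ‖ ^ 2 * totalVariance μ Z) ^ 2 := by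
        gcongr
        · exact integral_sq_inner_mul_min_le hZ ξ
        · exact variance_nonneg _ _
    _ = ‖ξ‖ ^ 2 * (totalVariance μ Z * lindebergRatio μ Z ‖ξ‖) := by
        rw [totalVariance_mul_lindebergRatio hZ]; ring

variable [MeasurableSpace E] [BorelSpace E]

lemma totalVariance_add {Y Z : S → E} (hY : MemLp Y 2 μ) (hZ : MemLp Z 2 μ)
    (hYZ : IndepFun Y Z μ) :
    totalVariance μ (Y + Z) = totalVariance μ Y + totalVariance μ Z := by
  have hY' : MemLp (fun s ↦ Y s - μ[Y]) 2 μ := hY.sub (memLp_const _)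
  have hZ' : MemLp (fun s ↦ Z s - μ[Z]) 2 μ := hZ.sub (memLp_const _)
  have hmean : ∫ s, (Y s + Z s) ∂μ = μ[Y] + μ[Z] :=
    integral_add (hY.integrable one_le_two) (hZ.integrable one_le_two)
  have hind : IndepFun (fun s ↦ Y s - μ[Y]) (fun s ↦ Z s - μ[Z]) μ :=
    hYZ.comp (measurable_sub_const (∫ s, Y s ∂μ)) (measurable_sub_const (∫ s, Z s ∂μ))
  have hcross : ∫ s, inner ℝ (Y s - μ[Y]) (Z s - μ[Z]) ∂μ = 0 := by
    refine (hind.integral_bilin (hY'.integrable one_le_two) (hZ'.integrable one_le_two)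
      (innerSL ℝ)).trans ?_
    rw [integral_sub (hY.integrable one_le_two) (integrable_const _)]
    simp
  have hcross_int : Integrable (fun s ↦ inner ℝ (Y s - μ[Y]) (Z s - μ[Z])) μ :=
    hind.integrable_bilin (hY'.integrable one_le_two) (hZ'.integrable one_le_two) (innerSL ℝ)
  have hexpand : ∀ s, ‖(Y + Z) s - μ[Y + Z]‖ ^ 2 =
      ‖Y s - μ[Y]‖ ^ 2 + 2 * inner ℝ (Y s - μ[Y]) (Z s - μ[Z]) + ‖Z s - μ[Z]‖ ^ 2 := by
    intro s
    simp only [Pi.add_apply, hmean]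
    rw [add_sub_add_comm, norm_add_sq_real]
  simp only [totalVariance, hexpand]
  have hsum_int : Integrable (fun s ↦
      ‖Y s - μ[Y]‖ ^ 2 + 2 * inner ℝ (Y s - μ[Y]) (Z s - μ[Z])) μ :=
    (integrable_sq_norm_sub_const hY _).add (hcross_int.const_mul 2)
  rw [integral_add hsum_int (integrable_sq_norm_sub_const hZ _),
    integral_add (integrable_sq_norm_sub_const hY _) (hcross_int.const_mul 2), integral_const_mul,
    hcross, mul_zero, add_zero]

variable [SecondCountableTopology E] {ι : Type*} {Z : ι → S → E}

lemma totalVariance_sum (hZ : ∀ i, MemLp (Z i) 2 μ) (hind : iIndepFun Z μ) (s : Finset ι) :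
    totalVariance μ (∑ i ∈ s, Z i) = ∑ i ∈ s, totalVariance μ (Z i) := by
  classical
  induction s using Finset.induction_on with
  | empty => simp [totalVariance]
  | insert i s hi ih =>
    rw [Finset.sum_insert hi, Finset.sum_insert hi, ← ih]
    refine totalVariance_add (hZ i) (memLp_finsetSum' s fun j _ ↦ hZ j) ?_
    exact (hind.indepFun_finsetSum_of_notMem₀
      (fun j ↦ (hZ j).aestronglyMeasurable.aemeasurable) hi).symm

lemma gaussianDefect_inner_sum_le (hZ : ∀ i, MemLp (Z i) 2 μ) (hind : iIndepFun Z μ)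
    (s : Finset ι) (ξ : E) :
    gaussianDefect μ (fun x ↦ inner ℝ ξ ((∑ i ∈ s, Z i) x)) ≤
      ‖ξ‖ ^ 2 * ∑ i ∈ s, totalVariance μ (Z i) * lindebergRatio μ (Z i) ‖ξ‖ := by
  have hinner : (fun x ↦ inner ℝ ξ ((∑ i ∈ s, Z i) x)) = ∑ i ∈ s, fun x ↦ inner ℝ ξ (Z i x) := by
    ext x; simp only [Finset.sum_apply, inner_sum]
  rw [hinner, Finset.mul_sum]
  exact (gaussianDefect_sum_le (fun i ↦ (hZ i).const_inner ξ)
    (hind.comp (fun _ z ↦ inner ℝ ξ z) fun _ ↦ by fun_prop) s).trans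
    (Finset.sum_le_sum fun i _ ↦ gaussianDefect_inner_le (hZ i) ξ)

end Lindeberg

section IsometricSum

variable {S E ι : Type*} [MeasurableSpace S] {μ : Measure S} [IsProbabilityMeasure μ]
  [NormedAddCommGroup E] [InnerProductSpace ℝ E] [CompleteSpace E] [MeasurableSpace E]
  [BorelSpace E] [SecondCountableTopology E] {Z : ι → S → E} {W : S → E}

lemma totalVariance_sum_linearIsometry (hident : ∀ i, IdentDistrib (Z i) W μ μ)
    (hind : iIndepFun Z μ) (hW : MemLp W 2 μ) (L : ι → E →ₗᵢ[ℝ] E) (s : Finset ι) :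
    totalVariance μ (∑ i ∈ s, fun x ↦ L i (Z i x)) = s.card * totalVariance μ W := by
  have hLZ (i : ι) : MemLp (fun x ↦ L i (Z i x)) 2 μ :=
    (L i).toContinuousLinearMap.comp_memLp' ((hident i).symm.memLp_snd hW)
  rw [totalVariance_sum hLZ (hind.comp (fun i z ↦ L i z) fun i ↦ by fun_prop)]
  simp only [totalVariance_linearIsometry_comp (hident _), Finset.sum_const, nsmul_eq_mul]

lemma gaussianDefect_inner_sum_linearIsometry_le (hident : ∀ i, IdentDistrib (Z i) W μ μ)
    (hind : iIndepFun Z μ) (hW : MemLp W 2 μ) (L : ι → E →ₗᵢ[ℝ] E) (s : Finset ι) (ξ : E) :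
    gaussianDefect μ (fun x ↦ inner ℝ ξ ((∑ i ∈ s, fun x ↦ L i (Z i x)) x)) ≤
      ‖ξ‖ ^ 2 * (s.card * totalVariance μ W * lindebergRatio μ W ‖ξ‖) := by
  have hLZ (i : ι) : MemLp (fun x ↦ L i (Z i x)) 2 μ :=
    (L i).toContinuousLinearMap.comp_memLp' ((hident i).symm.memLp_snd hW)
  refine (gaussianDefect_inner_sum_le hLZ (hind.comp (fun i z ↦ L i z) fun i ↦ by fun_prop)
    s ξ).trans_eq ?_
  simp only [totalVariance_linearIsometry_comp (hident _),
    lindebergRatio_linearIsometry_comp (hident _), Finset.sum_const, nsmul_eq_mul, mul_assoc]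

end IsometricSum

section Envelope

variable {S : Type*}

/-- Phasor of a RIS column, without its deterministic phase. -/
noncomputable def risPhasor (X : Randomness S) (m : ℕ) (s : S) : ℂ :=
  X.c m s * Complex.exp (X.δ m s * Complex.I)

/-- Phasor of a direct multipath component at time `t`. -/
noncomputable def directPhasor (X : Randomness S) (t : ℝ) (n : ℕ) (s : S) : ℂ :=
  X.b n s * Complex.exp ((X.ω n s * t + X.θ n s : ℝ) * Complex.I)

/-- Deterministic phase of a RIS column, as an isometry of the plane so that it preserves total
variances. -/
noncomputable def risRotation (g : Config) (t : ℝ) (m : ℕ) : ℂ →ₗᵢ[ℝ] ℂ :=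
  (rotation (Circle.exp (g.ω₀ * t + g.θ₀ - g.ε * (m + 1) + g.φ m))).toLinearIsometry

/-- Contribution of the RIS to the complex envelope. -/
noncomputable def risSignal (X : Randomness S) (g : Config) (t : ℝ) (M : ℕ) : S → ℂ :=
  ∑ m ∈ Finset.range M, fun s ↦ risRotation g t m (risPhasor X m s)

/-- Contribution of the direct link to the complex envelope. -/
noncomputable def directSignal (X : Randomness S) (t : ℝ) (N : ℕ) : S → ℂ :=
  ∑ n ∈ Finset.range N, directPhasor X t n

lemma ofReal_mul_exp_mul_I (a x : ℝ) :
    a * Complex.exp (x * Complex.I) =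
      ((a * Real.cos x : ℝ) : ℂ) + Complex.I * ((a * Real.sin x : ℝ) : ℂ) := by
  rw [Complex.exp_mul_I]
  push_cast
  ring

lemma risRotation_risPhasor (X : Randomness S) (g : Config) (t : ℝ) (m : ℕ) (s : S) :
    risRotation g t m (risPhasor X m s) = X.c m s * Complex.exp
      ((g.ω₀ * t + g.θ₀ - g.ε * (m + 1) + (g.φ m + X.δ m s) : ℝ) * Complex.I) := by
  simp only [risRotation, LinearIsometryEquiv.coe_toLinearIsometry, rotation_apply,
    Circle.coe_exp, risPhasor]
  rw [mul_left_comm, ← Complex.exp_add]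
  push_cast
  ring_nf

lemma complexEnvelope_eq (X : Randomness S) (g : Config) (t : ℝ) (M N : ℕ) :
    complexEnvelope X g t M N = risSignal X g t M + directSignal X t N := by
  ext s
  simp only [Pi.add_apply, risSignal, directSignal, Finset.sum_apply, risRotation_risPhasor,
    directPhasor, ofReal_mul_exp_mul_I, Finset.sum_add_distrib, ← Finset.mul_sum]
  simp only [complexEnvelope, Tc, Ts, Complex.ofReal_add, Complex.ofReal_sum]
  ring

lemma complexEnvelope_re (X : Randomness S) (g : Config) (t : ℝ) (M N : ℕ) (s : S) :
    (complexEnvelope X g t M N s).re = Tc X g t M N s := by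
  simp [complexEnvelope]

lemma complexEnvelope_im (X : Randomness S) (g : Config) (t : ℝ) (M N : ℕ) (s : S) :
    (complexEnvelope X g t M N s).im = Ts X g t M N s := by
  simp [complexEnvelope]

variable [MeasurableSpace S] {μ : Measure S} {X : Randomness S}

namespace Randomness.IsIID

lemma identDistrib_risPhasor (hX : X.IsIID μ) (m : ℕ) :
    IdentDistrib (risPhasor X m) (risPhasor X 0) μ μ :=
  (hX.identDistrib_ris m).comp (u := fun p : ℝ × ℝ ↦ (p.1 : ℂ) * Complex.exp (p.2 * Complex.I))
    (by fun_prop)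

lemma iIndepFun_risPhasor (hX : X.IsIID μ) : iIndepFun (risPhasor X) μ :=
  hX.iIndep_ris.comp (fun _ (p : ℝ × ℝ) ↦ (p.1 : ℂ) * Complex.exp (p.2 * Complex.I))
    fun _ ↦ by fun_prop

lemma identDistrib_directPhasor (hX : X.IsIID μ) (t : ℝ) (n : ℕ) :
    IdentDistrib (directPhasor X t n) (directPhasor X t 0) μ μ :=
  (hX.identDistrib_direct n).comp (u := fun p : ℝ × ℝ × ℝ ↦
    (p.1 : ℂ) * Complex.exp ((p.2.1 * t + p.2.2 : ℝ) * Complex.I)) (by fun_prop)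

lemma iIndepFun_directPhasor (hX : X.IsIID μ) (t : ℝ) : iIndepFun (directPhasor X t) μ :=
  hX.iIndep_direct.comp (fun _ (p : ℝ × ℝ × ℝ) ↦
    (p.1 : ℂ) * Complex.exp ((p.2.1 * t + p.2.2 : ℝ) * Complex.I)) fun _ ↦ by fun_prop

lemma memLp_risPhasor (hX : X.IsIID μ) : MemLp (risPhasor X 0) 2 μ := by
  refine hX.memLp_c.of_le (hX.identDistrib_risPhasor 0).aemeasurable_fst.aestronglyMeasurable
    (Eventually.of_forall fun s ↦ ?_)
  rw [risPhasor, norm_mul, Complex.norm_exp_ofReal_mul_I, mul_one, Complex.norm_real]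

lemma memLp_directPhasor (hX : X.IsIID μ) (t : ℝ) : MemLp (directPhasor X t 0) 2 μ := by
  refine hX.memLp_b.of_le (hX.identDistrib_directPhasor t 0).aemeasurable_fst.aestronglyMeasurable
    (Eventually.of_forall fun s ↦ ?_)
  rw [directPhasor, norm_mul, Complex.norm_exp_ofReal_mul_I, mul_one, Complex.norm_real]

lemma indepFun_risSignal_directSignal (hX : X.IsIID μ) (g : Config) (t : ℝ) (M N : ℕ) :
    IndepFun (risSignal X g t M) (directSignal X t N) μ := by
  have h := hX.indep.comp
    (φ := fun p : ℕ → ℝ × ℝ ↦ ∑ m ∈ Finset.range M,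
      risRotation g t m ((p m).1 * Complex.exp ((p m).2 * Complex.I)))
    (ψ := fun p : ℕ → ℝ × ℝ × ℝ ↦ ∑ n ∈ Finset.range N,
      (p n).1 * Complex.exp (((p n).2.1 * t + (p n).2.2 : ℝ) * Complex.I))
    (by fun_prop) (by fun_prop)
  convert h using 1 <;> ext s <;>
    simp [risSignal, directSignal, risPhasor, directPhasor]

lemma memLp_risSignal (hX : X.IsIID μ) (g : Config) (t : ℝ) (M : ℕ) :
    MemLp (risSignal X g t M) 2 μ :=
  memLp_finsetSum' _ fun m _ ↦ (risRotation g t m).toContinuousLinearMap.comp_memLp'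
    ((hX.identDistrib_risPhasor m).symm.memLp_snd hX.memLp_risPhasor)

lemma memLp_directSignal (hX : X.IsIID μ) (t : ℝ) (N : ℕ) : MemLp (directSignal X t N) 2 μ :=
  memLp_finsetSum' _ fun n _ ↦
    (hX.identDistrib_directPhasor t n).symm.memLp_snd (hX.memLp_directPhasor t)

lemma memLp_complexEnvelope (hX : X.IsIID μ) (g : Config) (t : ℝ) (M N : ℕ) :
    MemLp (complexEnvelope X g t M N) 2 μ :=
  complexEnvelope_eq X g t M N ▸ (hX.memLp_risSignal g t M).add (hX.memLp_directSignal t N)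

lemma memLp_Tc (hX : X.IsIID μ) (g : Config) (t : ℝ) (M N : ℕ) : MemLp (Tc X g t M N) 2 μ := by
  have h : MemLp (fun s ↦ (complexEnvelope X g t M N s).re) 2 μ :=
    (hX.memLp_complexEnvelope g t M N).re
  simpa only [complexEnvelope_re] using h

lemma memLp_Ts (hX : X.IsIID μ) (g : Config) (t : ℝ) (M N : ℕ) : MemLp (Ts X g t M N) 2 μ := by
  have h : MemLp (fun s ↦ (complexEnvelope X g t M N s).im) 2 μ :=
    (hX.memLp_complexEnvelope g t M N).im
  simpa only [complexEnvelope_im] using h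

lemma integral_complexEnvelope_re (hX : X.IsIID μ) [IsProbabilityMeasure μ] (g : Config) (t : ℝ)
    (M N : ℕ) : (μ[complexEnvelope X g t M N]).re = μ[Tc X g t M N] := by
  have h : ∫ s, (complexEnvelope X g t M N s).re ∂μ = (μ[complexEnvelope X g t M N]).re :=
    integral_re ((hX.memLp_complexEnvelope g t M N).integrable one_le_two)
  simpa only [complexEnvelope_re] using h.symm

lemma integral_complexEnvelope_im (hX : X.IsIID μ) [IsProbabilityMeasure μ] (g : Config) (t : ℝ)
    (M N : ℕ) : (μ[complexEnvelope X g t M N]).im = μ[Ts X g t M N] := by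
  have h : ∫ s, (complexEnvelope X g t M N s).im ∂μ = (μ[complexEnvelope X g t M N]).im :=
    integral_im ((hX.memLp_complexEnvelope g t M N).integrable one_le_two)
  simpa only [complexEnvelope_im] using h.symm

variable [IsProbabilityMeasure μ]

lemma XiSq_eq (hX : X.IsIID μ) (g : Config) (t : ℝ) (M N : ℕ) :
    XiSq X μ g t M N = ‖μ[complexEnvelope X g t M N]‖ ^ 2 := by
  rw [Complex.sq_norm, Complex.normSq_apply, hX.integral_complexEnvelope_re,
    hX.integral_complexEnvelope_im, XiSq]
  ring

lemma sigma_eq_totalVariance (hX : X.IsIID μ) (g : Config) (t : ℝ) (M N : ℕ) :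
    sigma X μ g t M N = totalVariance μ (complexEnvelope X g t M N) := by
  have hTc := hX.memLp_Tc g t M N
  have hTs := hX.memLp_Ts g t M N
  have hre : Integrable (fun s ↦ (Tc X g t M N s - μ[Tc X g t M N]) ^ 2) μ :=
    (hTc.sub (memLp_const _)).integrable_sq
  have him : Integrable (fun s ↦ (Ts X g t M N s - μ[Ts X g t M N]) ^ 2) μ :=
    (hTs.sub (memLp_const _)).integrable_sq
  rw [sigma, totalVariance, variance_eq_integral hTc.aestronglyMeasurable.aemeasurable,
    variance_eq_integral hTs.aestronglyMeasurable.aemeasurable, ← integral_add hre him]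
  congr with s
  rw [Complex.sq_norm, Complex.normSq_apply, Complex.sub_re, Complex.sub_im, complexEnvelope_re,
    complexEnvelope_im, hX.integral_complexEnvelope_re, hX.integral_complexEnvelope_im]
  ring

lemma sigma_eq (hX : X.IsIID μ) (g : Config) (t : ℝ) (M N : ℕ) :
    sigma X μ g t M N =
      M * totalVariance μ (risPhasor X 0) + N * totalVariance μ (directPhasor X t 0) := by
  rw [hX.sigma_eq_totalVariance, complexEnvelope_eq,
    totalVariance_add (hX.memLp_risSignal g t M) (hX.memLp_directSignal t N)
      (hX.indepFun_risSignal_directSignal g t M N)]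
  congr 1
  · exact (totalVariance_sum_linearIsometry hX.identDistrib_risPhasor hX.iIndepFun_risPhasor
      hX.memLp_risPhasor (risRotation g t) _).trans (by rw [Finset.card_range])
  · exact (totalVariance_sum_linearIsometry (hX.identDistrib_directPhasor t)
      (hX.iIndepFun_directPhasor t) (hX.memLp_directPhasor t) (fun _ ↦ .id) _).trans
      (by rw [Finset.card_range])

lemma gaussianDefect_inner_complexEnvelope_le (hX : X.IsIID μ) (g : Config) (t : ℝ) (M N : ℕ)
    (ξ : ℂ) :
    gaussianDefect μ (fun s ↦ inner ℝ ξ (complexEnvelope X g t M N s)) ≤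
      ‖ξ‖ ^ 2 * sigma X μ g t M N *
        (lindebergRatio μ (risPhasor X 0) ‖ξ‖ + lindebergRatio μ (directPhasor X t 0) ‖ξ‖) := by
  have hinner : (fun s ↦ inner ℝ ξ (complexEnvelope X g t M N s)) =
      (fun s ↦ inner ℝ ξ (risSignal X g t M s)) + fun s ↦ inner ℝ ξ (directSignal X t N s) := by
    ext s; simp only [complexEnvelope_eq, Pi.add_apply, inner_add_right]
  have hris := gaussianDefect_inner_sum_linearIsometry_le hX.identDistrib_risPhasor
    hX.iIndepFun_risPhasor hX.memLp_risPhasor (risRotation g t) (Finset.range M) ξ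
  have hdirect := gaussianDefect_inner_sum_linearIsometry_le (hX.identDistrib_directPhasor t)
    (hX.iIndepFun_directPhasor t) (hX.memLp_directPhasor t) (fun _ ↦ .id) (Finset.range N) ξ
  rw [Finset.card_range] at hris hdirect
  have hV₁ : 0 ≤ totalVariance μ (risPhasor X 0) := totalVariance_nonneg
  have hV₂ : 0 ≤ totalVariance μ (directPhasor X t 0) := totalVariance_nonneg
  have hL₁ : 0 ≤ lindebergRatio μ (risPhasor X 0) ‖ξ‖ := lindebergRatio_nonneg (norm_nonneg ξ)
  have hL₂ : 0 ≤ lindebergRatio μ (directPhasor X t 0) ‖ξ‖ := lindebergRatio_nonneg (norm_nonneg ξ)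
  rw [hinner]
  refine ((gaussianDefect_add_le ((hX.memLp_risSignal g t M).const_inner ξ)
    ((hX.memLp_directSignal t N).const_inner ξ)
    ((hX.indepFun_risSignal_directSignal g t M N).comp (φ := fun z ↦ inner ℝ ξ z)
      (ψ := fun z ↦ inner ℝ ξ z) (by fun_prop) (by fun_prop))).trans
    (add_le_add hris hdirect)).trans ?_
  rw [← mul_add, mul_assoc (‖ξ‖ ^ 2), mul_add (sigma X μ g t M N), hX.sigma_eq g t M N]
  gcongr
  · exact le_add_of_nonneg_right (by positivity)
  · exact le_add_of_nonneg_left (by positivity)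

lemma variance_inner_complexEnvelope (hX : X.IsIID μ) {g : Config} {t : ℝ} {M N : ℕ}
    (hB : Balanced X μ g t M N) (ξ : ℂ) :
    variance (fun s ↦ inner ℝ ξ (complexEnvelope X g t M N s)) μ =
      ‖ξ‖ ^ 2 * sigma X μ g t M N / 2 := by
  have hinner : (fun s ↦ inner ℝ ξ (complexEnvelope X g t M N s)) =
      (fun s ↦ ξ.re * Tc X g t M N s) + fun s ↦ ξ.im * Ts X g t M N s := by
    ext s
    simp only [Complex.inner, Complex.mul_re, Complex.conj_re, Complex.conj_im,
      complexEnvelope_re, complexEnvelope_im, Pi.add_apply]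
    ring
  obtain ⟨-, hvar, hcov⟩ := hB
  rw [hinner, variance_add ((hX.memLp_Tc g t M N).const_mul _) ((hX.memLp_Ts g t M N).const_mul _),
    variance_const_mul, variance_const_mul, covariance_const_mul_left, covariance_const_mul_right,
    hcov, sigma, hvar, Complex.sq_norm, Complex.normSq_apply]
  ring

end Randomness.IsIID

end Envelope

section RicianApproximation

variable {S : Type*} [MeasurableSpace S] {μ : Measure S} {X : Randomness S}

/-- Balanced choices `(M, N, g)` with `M` and `N` both tending to infinity. Limits along this filter
are uniform in the deterministic parameters `g`. -/
def balancedAtTop (X : Randomness S) (μ : Measure S) (t : ℝ) : Filter (ℕ × ℕ × Config) :=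
  comap (fun p ↦ min p.1 p.2.1) atTop ⊓ 𝓟 {p | Balanced X μ p.2.2 t p.1 p.2.1}

instance (t : ℝ) : (balancedAtTop X μ t).IsCountablyGenerated := by
  unfold balancedAtTop; infer_instance

lemma eventually_balancedAtTop {t : ℝ} {P : ℕ × ℕ × Config → Prop} :
    (∀ᶠ p in balancedAtTop X μ t, P p) ↔ ∃ n₀ : ℕ, ∀ M N, n₀ ≤ M → n₀ ≤ N →
      ∀ g, Balanced X μ g t M N → P (M, N, g) := by
  simp only [balancedAtTop, eventually_inf_principal, eventually_comap, eventually_atTop]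
  refine ⟨fun ⟨n₀, h⟩ ↦ ⟨n₀, fun M N hM hN g ↦ h _ (le_min hM hN) (M, N, g) rfl⟩,
    fun ⟨n₀, h⟩ ↦ ⟨n₀, ?_⟩⟩
  rintro _ hn p rfl
  exact h _ _ (hn.trans (min_le_left _ _)) (hn.trans (min_le_right _ _)) _

/-- Centred complex envelope divided by `√σ`. -/
noncomputable def normalizedFluctuation (X : Randomness S) (μ : Measure S) (g : Config) (t : ℝ)
    (M N : ℕ) (s : S) : ℂ :=
  (√(sigma X μ g t M N))⁻¹ • (complexEnvelope X g t M N s - μ[complexEnvelope X g t M N])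

lemma norm_sqrt_mul_add_le_iff {σ : ℝ} (hσ : 0 < σ) (z b : ℂ) (x : ℝ) :
    ‖(√σ : ℂ) * z + b‖ ≤ x ↔ ‖z + b / √σ‖ ≤ x / √σ := by
  have hs : 0 < √σ := Real.sqrt_pos.2 hσ
  have hs' : (√σ : ℂ) ≠ 0 := by exact_mod_cast hs.ne'
  have hfactor : (√σ : ℂ) * z + b = √σ * (z + b / √σ) := by field_simp
  rw [hfactor, norm_mul, Complex.norm_of_nonneg hs.le, le_div_iff₀' hs]

lemma ricianMeasure_real_Iic {σ : ℝ} (hσ : 0 < σ) (b : ℂ) (x : ℝ) :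
    (ricianMeasure (‖b‖ ^ 2 / σ) (‖b‖ ^ 2 + σ)).real (Iic x) =
      complexGaussian.real {z | ‖z + b / √σ‖ ≤ x / √σ} := by
  rw [← map_norm_sqrt_mul_add_complexGaussian hσ,
    map_measureReal_apply (by fun_prop) measurableSet_Iic]
  simp only [preimage, mem_Iic, norm_sqrt_mul_add_le_iff hσ]

namespace Randomness.IsIID

lemma aemeasurable_normalizedFluctuation (hX : X.IsIID μ) (g : Config) (t : ℝ) (M N : ℕ) :
    AEMeasurable (normalizedFluctuation X μ g t M N) μ := by
  have := (hX.memLp_complexEnvelope g t M N).aestronglyMeasurable.aemeasurable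
  unfold normalizedFluctuation
  fun_prop

lemma measureReal_norm_complexEnvelope_le (hX : X.IsIID μ) {g : Config} {t : ℝ} {M N : ℕ}
    (hσ : 0 < sigma X μ g t M N) (x : ℝ) :
    μ.real {s | ‖complexEnvelope X g t M N s‖ ≤ x} =
      (μ.map (normalizedFluctuation X μ g t M N)).real
        {z | ‖z + μ[complexEnvelope X g t M N] / √(sigma X μ g t M N)‖ ≤
          x / √(sigma X μ g t M N)} := by
  have hs : (√(sigma X μ g t M N) : ℂ) ≠ 0 := by exact_mod_cast (Real.sqrt_pos.2 hσ).ne'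
  rw [map_measureReal_apply_of_aemeasurable (hX.aemeasurable_normalizedFluctuation g t M N)
    (measurableSet_le (by fun_prop) measurable_const)]
  simp only [preimage, mem_ofPred_eq, ← norm_sqrt_mul_add_le_iff hσ, normalizedFluctuation,
    Complex.real_smul, Complex.ofReal_inv, mul_inv_cancel_left₀ hs, sub_add_cancel]

variable [IsProbabilityMeasure μ]

lemma norm_charFun_normalizedFluctuation_sub (hX : X.IsIID μ) {g : Config} {t : ℝ} {M N : ℕ}
    (hB : Balanced X μ g t M N) (ξ : ℂ) :
    ‖charFun (μ.map (normalizedFluctuation X μ g t M N)) ξ - charFun complexGaussian ξ‖ =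
      gaussianDefect μ fun s ↦
        inner ℝ ((√(sigma X μ g t M N))⁻¹ • ξ) (complexEnvelope X g t M N s) := by
  have hσ := hB.1
  rw [charFun_complexGaussian, charFun_apply, integral_map
    (hX.aemeasurable_normalizedFluctuation g t M N) (by fun_prop), gaussianDefect,
    hX.variance_inner_complexEnvelope hB,
    integral_inner ((hX.memLp_complexEnvelope g t M N).integrable one_le_two)]
  congr 3
  · congr with s
    rw [normalizedFluctuation, real_inner_smul_left, real_inner_comm, ← inner_sub_right,
      real_inner_smul_left]
  · rw [norm_smul, Real.norm_of_nonneg (by positivity), mul_pow, inv_pow, Real.sq_sqrt hσ.le]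
    field_simp
    norm_num

lemma norm_charFun_normalizedFluctuation_sub_le (hX : X.IsIID μ) {g : Config} {t : ℝ} {M N : ℕ}
    (hB : Balanced X μ g t M N) (ξ : ℂ) :
    ‖charFun (μ.map (normalizedFluctuation X μ g t M N)) ξ - charFun complexGaussian ξ‖ ≤
      ‖ξ‖ ^ 2 * (lindebergRatio μ (risPhasor X 0) ((√(sigma X μ g t M N))⁻¹ * ‖ξ‖) +
        lindebergRatio μ (directPhasor X t 0) ((√(sigma X μ g t M N))⁻¹ * ‖ξ‖)) := by
  have hσ := hB.1
  rw [hX.norm_charFun_normalizedFluctuation_sub hB]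
  refine (hX.gaussianDefect_inner_complexEnvelope_le g t M N _).trans_eq ?_
  rw [norm_smul, Real.norm_of_nonneg (by positivity), mul_pow, inv_pow, Real.sq_sqrt hσ.le]
  field_simp

lemma tendsto_sigma_balancedAtTop (hX : X.IsIID μ) (t : ℝ) :
    Tendsto (fun p : ℕ × ℕ × Config ↦ sigma X μ p.2.2 t p.1 p.2.1) (balancedAtTop X μ t) atTop := by
  have hV₁ : 0 ≤ totalVariance μ (risPhasor X 0) := totalVariance_nonneg
  have hV₂ : 0 ≤ totalVariance μ (directPhasor X t 0) := totalVariance_nonneg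
  rcases (add_nonneg hV₁ hV₂).eq_or_lt with hzero | hpos
  · refine Tendsto.mono_left tendsto_bot (le_of_eq ?_)
    rw [← eventually_false_iff_eq_bot, eventually_balancedAtTop]
    refine ⟨0, fun M N _ _ g hB ↦ hB.1.ne' ?_⟩
    rw [hX.sigma_eq, (add_eq_zero_iff_of_nonneg hV₁ hV₂).1 hzero.symm |>.1,
      (add_eq_zero_iff_of_nonneg hV₁ hV₂).1 hzero.symm |>.2]
    simp
  · have hmin : Tendsto (fun p : ℕ × ℕ × Config ↦ min p.1 p.2.1) (balancedAtTop X μ t) atTop :=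
      tendsto_comap.mono_left inf_le_left
    refine tendsto_atTop_mono (fun p ↦ ?_)
      ((tendsto_natCast_atTop_atTop.comp hmin).atTop_mul_const hpos)
    rw [hX.sigma_eq, mul_add]
    simp only [Function.comp_apply]
    gcongr
    · exact min_le_left _ _
    · exact min_le_right _ _

lemma tendsto_charFun_normalizedFluctuation (hX : X.IsIID μ) (t : ℝ) (ξ : ℂ) :
    Tendsto (fun p : ℕ × ℕ × Config ↦
        charFun (μ.map (normalizedFluctuation X μ p.2.2 t p.1 p.2.1)) ξ)
      (balancedAtTop X μ t) (𝓝 (charFun complexGaussian ξ)) := by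
  have hfreq : Tendsto (fun p : ℕ × ℕ × Config ↦ (√(sigma X μ p.2.2 t p.1 p.2.1))⁻¹ * ‖ξ‖)
      (balancedAtTop X μ t) (𝓝[≥] 0) := by
    refine tendsto_nhdsWithin_iff.2 ⟨?_, Eventually.of_forall fun p ↦ by
      simp only [mem_Ici]; positivity⟩
    simpa using ((Real.tendsto_sqrt_atTop.comp
      (hX.tendsto_sigma_balancedAtTop t)).inv_tendsto_atTop).mul_const ‖ξ‖
  have hbound := (((tendsto_lindebergRatio hX.memLp_risPhasor).comp hfreq).add
    ((tendsto_lindebergRatio (hX.memLp_directPhasor t)).comp hfreq)).const_mul (‖ξ‖ ^ 2)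
  rw [add_zero, mul_zero] at hbound
  refine tendsto_iff_norm_sub_tendsto_zero.2 (squeeze_zero' ?_ ?_ hbound)
  · exact Eventually.of_forall fun p ↦ norm_nonneg _
  · exact eventually_balancedAtTop.2 ⟨0, fun M N _ _ g hB ↦
      hX.norm_charFun_normalizedFluctuation_sub_le hB ξ⟩

lemma eventually_envelopeWithin_ricianMeasure (hX : X.IsIID μ) (t : ℝ) {η : ℝ} (hη : 0 < η) :
    ∀ᶠ p in balancedAtTop X μ t, EnvelopeWithin X μ p.2.2 t p.1 p.2.1
      (ricianMeasure (KEff X μ p.2.2 t p.1 p.2.1) (scale X μ p.2.2 t p.1 p.2.1)) η := by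
  let ν (p : ℕ × ℕ × Config) : ProbabilityMeasure ℂ :=
    ⟨μ.map (normalizedFluctuation X μ p.2.2 t p.1 p.2.1),
      Measure.isProbabilityMeasure_map (hX.aemeasurable_normalizedFluctuation _ _ _ _)⟩
  let ν₀ : ProbabilityMeasure ℂ := ⟨complexGaussian, inferInstance⟩
  have hν : Tendsto ν (balancedAtTop X μ t) (𝓝 ν₀) :=
    tendsto_of_tendsto_charFun (hX.tendsto_charFun_normalizedFluctuation t)
  have hball : ∀ᶠ p in balancedAtTop X μ t, ∀ a : ℂ, ∀ r : ℝ,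
      |(μ.map (normalizedFluctuation X μ p.2.2 t p.1 p.2.1)).real {z | ‖z + a‖ ≤ r} -
        complexGaussian.real {z | ‖z + a‖ ≤ r}| ≤ η :=
    eventually_forall_abs_measureReal_sublevel_sub_le hν (f := fun a z ↦ ‖z + a‖)
      (fun a ↦ LipschitzWith.of_le_add fun z w ↦ by
        simpa [dist_eq_norm, add_sub_add_right_eq_sub] using
          norm_le_norm_add_norm_sub' (z + a) (w + a))
      zero_le_two
      (fun a r ε hε ↦ complexGaussian_real_annulus_le a r hε) hη
  have hbalanced : ∀ᶠ p in balancedAtTop X μ t, Balanced X μ p.2.2 t p.1 p.2.1 :=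
    eventually_balancedAtTop.2 ⟨0, fun _ _ _ _ _ hB ↦ hB⟩
  filter_upwards [hball, hbalanced] with p hp hB x
  rw [KEff, scale, hX.XiSq_eq, ricianMeasure_real_Iic hB.1,
    hX.measureReal_norm_complexEnvelope_le hB.1]
  exact hp _ _

end Randomness.IsIID

end RicianApproximation

section Gamma

variable {a r : ℝ}

lemma gammaMeasure_eq_withDensity_Ioi (a r : ℝ) :
    gammaMeasure a r = (volume.restrict (Ioi 0)).withDensity (gammaPDF a r) := by
  rw [gammaMeasure, withDensity_congr_ae (g := (Ioi (0 : ℝ)).indicator (gammaPDF a r)),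
    withDensity_indicator measurableSet_Ioi]
  filter_upwards [Measure.ae_ne volume 0] with x hx
  rcases hx.lt_or_gt with h | h
  · rw [indicator_of_notMem (by simpa using h.le), gammaPDF_of_neg h]
  · rw [indicator_of_mem (mem_Ioi.2 h)]

lemma integral_gammaMeasure (ha : 0 < a) (hr : 0 < r) (f : ℝ → ℝ) :
    ∫ x, f x ∂(gammaMeasure a r) =
      ∫ x in Ioi (0 : ℝ), r ^ a / Real.Gamma a * (x ^ (a - 1) * Real.exp (-(r * x))) * f x := by
  rw [gammaMeasure_eq_withDensity_Ioi]
  change ∫ x, f x ∂((volume.restrict (Ioi 0)).withDensity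
    fun x ↦ ((gammaPDFReal a r x).toNNReal : ENNReal)) = _
  rw [integral_withDensity_eq_integral_smul (measurable_gammaPDFReal a r).real_toNNReal]
  refine setIntegral_congr_fun measurableSet_Ioi fun x (hx : 0 < x) ↦ ?_
  rw [NNReal.smul_def, Real.coe_toNNReal _ (gammaPDFReal_nonneg ha hr x), gammaPDFReal,
    if_pos hx.le, smul_eq_mul, mul_assoc (r ^ a / Real.Gamma a)]

lemma mgf_gammaMeasure (ha : 0 < a) (hr : 0 < r) {t : ℝ} (ht : t < r) :
    mgf id (gammaMeasure a r) t = (1 - t / r) ^ (-a) := by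
  have := Real.Gamma_pos_of_pos ha
  have hexp (x : ℝ) : r ^ a / Real.Gamma a * (x ^ (a - 1) * Real.exp (-(r * x))) *
      Real.exp (t * id x) =
        r ^ a / Real.Gamma a * (x ^ (a - 1) * Real.exp (-((r - t) * x))) := by
    rw [mul_assoc, mul_assoc (x ^ (a - 1)), ← Real.exp_add, id, sub_mul, neg_sub,
      neg_add_eq_sub]
  rw [mgf, integral_gammaMeasure ha hr]
  simp_rw [hexp]
  rw [integral_const_mul, Real.integral_rpow_mul_exp_neg_mul_Ioi ha (sub_pos.2 ht),
    one_sub_div hr.ne', Real.rpow_neg (by have := sub_pos.2 ht; positivity),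
    Real.div_rpow (sub_pos.2 ht).le hr.le, Real.div_rpow zero_le_one (sub_pos.2 ht).le,
    Real.one_rpow]
  field_simp

lemma Iio_subset_integrableExpSet_gammaMeasure (ha : 0 < a) (hr : 0 < r) :
    Iio r ⊆ integrableExpSet id (gammaMeasure a r) := by
  intro t ht
  by_contra h
  have hmgf := mgf_gammaMeasure ha hr ht
  rw [mgf, integral_undef h] at hmgf
  exact (Real.rpow_pos_of_pos (sub_pos.2 ((div_lt_one hr).2 ht)) _).ne hmgf

lemma analyticOnNhd_exp_neg_mul_log (hr : 0 < r) :
    AnalyticOnNhd ℂ (fun z : ℂ ↦ Complex.exp (-a * Complex.log (1 - z / r))) {z | z.re < r} := by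
  refine DifferentiableOn.analyticOnNhd (fun z hz ↦ ?_)
    (isOpen_lt Complex.continuous_re continuous_const)
  have hslit : 1 - z / r ∈ Complex.slitPlane :=
    Or.inl (by simpa [Complex.div_ofReal_re] using (div_lt_one hr).2 hz)
  have hlog : DifferentiableAt ℂ (fun z : ℂ ↦ Complex.log (1 - z / r)) z :=
    DifferentiableAt.clog (by fun_prop) hslit
  exact (hlog.const_mul _).cexp.differentiableWithinAt

lemma complexMGF_gammaMeasure (ha : 0 < a) (hr : 0 < r) {z : ℂ} (hz : z.re < r) :
    complexMGF id (gammaMeasure a r) z = Complex.exp (-a * Complex.log (1 - z / r)) := by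
  have hanalytic : AnalyticOnNhd ℂ (complexMGF id (gammaMeasure a r)) {z | z.re < r} :=
    fun z hz ↦ analyticAt_complexMGF
      (interior_maximal (Iio_subset_integrableExpSet_gammaMeasure ha hr) isOpen_Iio hz)
  refine hanalytic.eqOn_of_preconnected_of_frequently_eq (analyticOnNhd_exp_neg_mul_log hr)
    (convex_halfSpace_re_lt r).isPreconnected (z₀ := 0) (by simpa using hr) ?_ hz
  have hreal : Tendsto (fun x : ℝ ↦ (x : ℂ)) (𝓝[≠] 0) (𝓝[≠] 0) := by
    simpa using Complex.continuous_ofReal.continuousWithinAt.tendsto_nhdsWithin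
      (s := {0}ᶜ) (x := 0) (t := {0}ᶜ) fun x hx ↦ by simpa using hx
  refine hreal.frequently (Eventually.frequently ?_)
  filter_upwards [nhdsWithin_le_nhds (Iio_mem_nhds hr)] with x hx
  have hpos : 0 < 1 - x / r := sub_pos.2 ((div_lt_one hr).2 hx)
  rw [complexMGF_ofReal, mgf_gammaMeasure ha hr hx, Real.rpow_def_of_pos hpos, Complex.ofReal_exp]
  push_cast [Complex.ofReal_log hpos.le]
  rw [mul_comm]

lemma zero_mem_interior_integrableExpSet_gammaMeasure (ha : 0 < a) (hr : 0 < r) :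
    0 ∈ interior (integrableExpSet id (gammaMeasure a r)) :=
  interior_maximal (Iio_subset_integrableExpSet_gammaMeasure ha hr) isOpen_Iio hr

lemma integral_pow_gammaMeasure (ha : 0 < a) (hr : 0 < r) (n : ℕ) :
    ∫ x, x ^ n ∂(gammaMeasure a r) = Real.Gamma (a + n) / (Real.Gamma a * r ^ n) := by
  have := Real.Gamma_pos_of_pos ha
  have hpow : ∀ x ∈ Ioi (0 : ℝ),
      r ^ a / Real.Gamma a * (x ^ (a - 1) * Real.exp (-(r * x))) * x ^ n =
        r ^ a / Real.Gamma a * (x ^ (a + n - 1) * Real.exp (-(r * x))) := fun x (hx : 0 < x) ↦ by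
    rw [add_sub_right_comm, Real.rpow_add_natCast hx.ne']
    ring
  rw [integral_gammaMeasure ha hr, setIntegral_congr_fun measurableSet_Ioi hpow,
    integral_const_mul, Real.integral_rpow_mul_exp_neg_mul_Ioi (by positivity) hr,
    Real.div_rpow zero_le_one hr.le, Real.one_rpow, Real.rpow_add_natCast hr.ne']
  field_simp

lemma integral_id_gammaMeasure (ha : 0 < a) (hr : 0 < r) :
    ∫ x, x ∂(gammaMeasure a r) = a / r := by
  have := Real.Gamma_pos_of_pos ha
  have hmoment := integral_pow_gammaMeasure ha hr 1
  simp only [pow_one, Nat.cast_one, Real.Gamma_add_one ha.ne'] at hmoment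
  rw [hmoment]
  field_simp

lemma variance_id_gammaMeasure (ha : 0 < a) (hr : 0 < r) :
    Var[id; gammaMeasure a r] = a / r ^ 2 := by
  have := isProbabilityMeasure_gammaMeasure ha hr
  have := Real.Gamma_pos_of_pos ha
  have hmoment : ∫ x, x ^ 2 ∂(gammaMeasure a r) = a * (a + 1) / r ^ 2 := by
    rw [integral_pow_gammaMeasure ha hr, Nat.cast_two, ← one_add_one_eq_two, ← add_assoc,
      Real.Gamma_add_one (by positivity), Real.Gamma_add_one ha.ne']
    field_simp
  rw [variance_eq_sub (memLp_of_mem_interior_integrableExpSet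
    (zero_mem_interior_integrableExpSet_gammaMeasure ha hr) 2)]
  simp only [Pi.pow_apply, id, hmoment, integral_id_gammaMeasure ha hr]
  field_simp
  ring

end Gamma

section StandardGamma

/-- The law of a Gamma variable of shape `m` after centring and scaling to variance one. -/
noncomputable def stdGamma (m : ℝ) : Measure ℝ :=
  (gammaMeasure m m).map fun y ↦ √m * (y - 1)

lemma isProbabilityMeasure_stdGamma {m : ℝ} (hm : 0 < m) : IsProbabilityMeasure (stdGamma m) := by
  have := isProbabilityMeasure_gammaMeasure hm hm
  exact Measure.isProbabilityMeasure_map (by fun_prop)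

lemma charFun_stdGamma {m : ℝ} (hm : 0 < m) (ξ : ℝ) :
    charFun (stdGamma m) ξ =
      Complex.exp (-m * Complex.log (1 - (ξ / √m : ℝ) * Complex.I) - √m * ξ * Complex.I) := by
  have hmap : stdGamma m =
      ((gammaMeasure m m).map fun y ↦ √m * y).map fun y ↦ y + -√m := by
    rw [stdGamma, Measure.map_map (by fun_prop) (by fun_prop)]
    congr 1
    ext y
    simp only [Function.comp_apply]
    ring
  have hdiv : ((√m * ξ : ℝ) : ℂ) * Complex.I / m = (ξ / √m : ℝ) * Complex.I := by
    rw [mul_div_right_comm, ← Complex.ofReal_div, mul_div_right_comm, Real.sqrt_div_self',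
      one_div_mul_eq_div]
  rw [hmap, charFun_map_add_const, charFun_map_mul, ← complexMGF_id_mul_I,
    complexMGF_gammaMeasure hm hm (by simpa using hm), hdiv, ← Complex.exp_add]
  congr 1
  simp
  ring

lemma memLp_id_stdGamma {m : ℝ} (hm : 0 < m) : MemLp id 2 (stdGamma m) := by
  have := isProbabilityMeasure_gammaMeasure hm hm
  have hid : MemLp id 2 (gammaMeasure m m) := memLp_of_mem_interior_integrableExpSet
    (zero_mem_interior_integrableExpSet_gammaMeasure hm hm) 2
  exact (memLp_map_measure_iff aestronglyMeasurable_id (by fun_prop)).2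
    ((hid.sub (memLp_const 1)).const_mul √m)

lemma integral_id_stdGamma {m : ℝ} (hm : 0 < m) : ∫ y, y ∂(stdGamma m) = 0 := by
  have := isProbabilityMeasure_gammaMeasure hm hm
  have hid : Integrable (fun y ↦ y) (gammaMeasure m m) :=
    memLp_one_iff_integrable.1 (memLp_of_mem_interior_integrableExpSet
      (zero_mem_interior_integrableExpSet_gammaMeasure hm hm) 1)
  rw [stdGamma, integral_map (by fun_prop) (by fun_prop), integral_const_mul,
    integral_sub hid (integrable_const _), integral_id_gammaMeasure hm hm]
  simp [hm.ne']

lemma variance_id_stdGamma {m : ℝ} (hm : 0 < m) : Var[id; stdGamma m] = 1 := by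
  have := isProbabilityMeasure_gammaMeasure hm hm
  rw [stdGamma, variance_id_map (by fun_prop), variance_const_mul,
    variance_sub_const (by fun_prop), Real.sq_sqrt hm.le]
  change m * Var[id; gammaMeasure m m] = 1
  rw [variance_id_gammaMeasure hm hm]
  field_simp

lemma continuousAt_charFun_stdGamma {m : ℝ} (hm : 0 < m) (ξ : ℝ) :
    ContinuousAt (fun m ↦ charFun (stdGamma m) ξ) m := by
  have hdiv : ContinuousAt (fun m ↦ ξ / √m) m :=
    continuousAt_const.div Real.continuous_sqrt.continuousAt (Real.sqrt_pos.2 hm).ne'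
  have hlog : ContinuousAt (fun m ↦ Complex.log (1 - (ξ / √m : ℝ) * Complex.I)) m :=
    ContinuousAt.clog (by fun_prop) (Or.inl (by simp))
  have hexp : ContinuousAt (fun m : ℝ ↦ Complex.exp
      (-m * Complex.log (1 - (ξ / √m : ℝ) * Complex.I) - √m * ξ * Complex.I)) m := by fun_prop
  refine hexp.congr ?_
  filter_upwards [Ioi_mem_nhds hm] with m hm
  exact (charFun_stdGamma hm ξ).symm

lemma norm_log_one_add_sub_le {w : ℂ} (hw : ‖w‖ ≤ 1 / 2) :
    ‖Complex.log (1 + w) - (w - w ^ 2 / 2)‖ ≤ ‖w‖ ^ 3 := by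
  have htaylor : Complex.logTaylor (2 + 1) w = w - w ^ 2 / 2 := by
    norm_num [Complex.logTaylor, Finset.sum_range_succ]
    ring
  have hinv : (1 - ‖w‖)⁻¹ ≤ 2 := by
    rw [inv_le_comm₀ (by linarith) two_pos]
    linarith
  rw [← htaylor]
  calc _ ≤ ‖w‖ ^ (2 + 1) * (1 - ‖w‖)⁻¹ / ((2 : ℕ) + 1) :=
        Complex.norm_log_sub_logTaylor_le 2 (by linarith)
    _ ≤ ‖w‖ ^ (2 + 1) * 2 / ((2 : ℕ) + 1) := by gcongr
    _ ≤ ‖w‖ ^ 3 := by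
        have : 0 ≤ ‖w‖ ^ 3 := by positivity
        norm_num
        linarith

lemma norm_neg_mul_log_add_sq_le {s ξ : ℝ} (hs : 0 < s) (hξ : |ξ| / s ≤ 1 / 2) :
    ‖-(s ^ 2 : ℂ) * Complex.log (1 - (ξ / s : ℝ) * Complex.I) - s * ξ * Complex.I + ξ ^ 2 / 2‖ ≤
      |ξ| ^ 3 / s := by
  have hs₀ : (s : ℂ) ≠ 0 := by exact_mod_cast hs.ne'
  set w : ℂ := -((ξ / s : ℝ) * Complex.I) with hw
  have hnorm : ‖w‖ = |ξ| / s := by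
    rw [hw, norm_neg, norm_mul, Complex.norm_I, mul_one, Complex.norm_real, Real.norm_eq_abs,
      abs_div, abs_of_pos hs]
  have hw₁ : (s : ℂ) ^ 2 * w = -(s * ξ * Complex.I) := by
    rw [hw]; push_cast; field_simp
  have hw₂ : (s : ℂ) ^ 2 * w ^ 2 = -(ξ : ℂ) ^ 2 := by
    rw [hw, neg_sq, mul_pow, Complex.I_sq]; push_cast; field_simp
  have herror : -(s ^ 2 : ℂ) * Complex.log (1 + w) - s * ξ * Complex.I + ξ ^ 2 / 2 =
      -(s : ℂ) ^ 2 * (Complex.log (1 + w) - (w - w ^ 2 / 2)) := by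
    linear_combination -hw₁ + hw₂ / 2
  rw [sub_eq_add_neg (1 : ℂ), ← hw, herror, norm_mul, norm_neg, norm_pow, Complex.norm_real,
    Real.norm_of_nonneg hs.le]
  calc _ ≤ s ^ 2 * ‖w‖ ^ 3 := by gcongr; exact norm_log_one_add_sub_le (hnorm ▸ hξ)
    _ = |ξ| ^ 3 / s := by rw [hnorm]; field_simp

lemma tendsto_charFun_stdGamma_atTop (ξ : ℝ) :
    Tendsto (fun m ↦ charFun (stdGamma m) ξ) atTop (𝓝 (charFun (gaussianReal 0 1) ξ)) := by
  have hexponent : Tendsto (fun m : ℝ ↦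
      -m * Complex.log (1 - (ξ / √m : ℝ) * Complex.I) - √m * ξ * Complex.I) atTop
      (𝓝 (-(ξ ^ 2 / 2))) := by
    rw [tendsto_iff_norm_sub_tendsto_zero]
    refine squeeze_zero' (Eventually.of_forall fun _ ↦ norm_nonneg _) ?_
      (Real.tendsto_sqrt_atTop.const_div_atTop (|ξ| ^ 3))
    filter_upwards [eventually_gt_atTop 0, (Real.tendsto_sqrt_atTop.const_div_atTop
      |ξ|).eventually_le_const (by norm_num : (0 : ℝ) < 1 / 2)] with m hm hξ
    have hm' : (m : ℂ) = (√m : ℂ) ^ 2 := by rw [← Complex.ofReal_pow, Real.sq_sqrt hm.le]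
    have hbound := norm_neg_mul_log_add_sq_le (Real.sqrt_pos.2 hm) hξ
    rwa [← hm', ← sub_neg_eq_add] at hbound
  rw [charFun_gaussianReal]
  refine Tendsto.congr' ?_ ((Complex.continuous_exp.tendsto _).comp (hexponent.trans_eq ?_))
  · filter_upwards [eventually_gt_atTop 0] with m hm
    exact (charFun_stdGamma hm ξ).symm
  · simp

end StandardGamma

section NakagamiGamma

lemma bijOn_sq_div_Ioi {Ωp : ℝ} (hΩ : 0 < Ωp) :
    BijOn (fun x ↦ x ^ 2 / Ωp) (Ioi 0) (Ioi 0) := by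
  refine ⟨fun x hx ↦ div_pos (pow_pos hx 2) hΩ, fun x hx y hy hxy ↦ ?_, fun y hy ↦ ?_⟩
  · exact (pow_left_inj₀ (le_of_lt hx) (le_of_lt hy) two_ne_zero).1
      ((div_left_inj' hΩ.ne').1 hxy)
  · have hpos : 0 < Ωp * y := mul_pos hΩ hy
    exact ⟨√(Ωp * y), Real.sqrt_pos.2 hpos, by
      simp only [Real.sq_sqrt hpos.le, mul_div_cancel_left₀ _ hΩ.ne']⟩

lemma nakagamiPDF_eq_mul_gammaPDFReal {m Ωp x : ℝ} (hm : 0 < m) (hΩ : 0 < Ωp) (hx : 0 < x) :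
    nakagamiPDF m Ωp x = 2 * x / Ωp * gammaPDFReal m m (x ^ 2 / Ωp) := by
  have hpow : (x ^ 2) ^ (m - 1) = x ^ (2 * m - 1) / x := by
    rw [← Real.rpow_natCast, ← Real.rpow_mul hx.le, ← Real.rpow_sub_one hx.ne']
    congr 1
    push_cast
    ring
  have := Real.Gamma_pos_of_pos hm
  have : 0 < Ωp ^ m := by positivity
  rw [gammaPDFReal, if_pos (by positivity), nakagamiPDF, Real.div_rpow (by positivity) hΩ.le, hpow,
    Real.rpow_sub_one hΩ.ne', show -m * x ^ 2 / Ωp = -(m * (x ^ 2 / Ωp)) by ring]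
  field_simp

lemma map_sq_div_nakagamiMeasure {m Ωp : ℝ} (hm : 0 < m) (hΩ : 0 < Ωp) :
    (nakagamiMeasure m Ωp).map (fun x ↦ x ^ 2 / Ωp) = gammaMeasure m m := by
  have hderiv (x : ℝ) (_ : x ∈ Ioi 0) :
      HasDerivWithinAt (fun x ↦ x ^ 2 / Ωp) (2 * x / Ωp) (Ioi 0) x := by
    simpa using (((hasDerivAt_id x).pow 2).div_const Ωp).hasDerivWithinAt
  rw [gammaMeasure_eq_withDensity_Ioi,
    ← map_withDensity_Ioi (by fun_prop) hderiv (bijOn_sq_div_Ioi hΩ), nakagamiMeasure]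
  congr 1
  refine withDensity_congr_ae ?_
  filter_upwards [ae_restrict_mem measurableSet_Ioi] with x (hx : 0 < x)
  rw [nakagamiPDF_eq_mul_gammaPDFReal hm hΩ hx, abs_of_pos (by positivity),
    ENNReal.ofReal_mul (by positivity), gammaPDF]

end NakagamiGamma

section QuadForm

/-- Linear combinations of the real part and the centred squared modulus; up to an affine change of
scale, these are the squares of the moduli of displaced circular Gaussian variables. -/
noncomputable def quadForm (α β : ℝ) (z : ℂ) : ℝ := α * z.re + β * (‖z‖ ^ 2 - 1)

@[fun_prop]
lemma continuous_quadForm (α β : ℝ) : Continuous (quadForm α β) := by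
  unfold quadForm
  fun_prop

/-- The law of `quadForm α β` under the standard circular Gaussian law. -/
noncomputable def quadFormLaw (α β : ℝ) : ProbabilityMeasure ℝ :=
  ⟨complexGaussian.map (quadForm α β),
    Measure.isProbabilityMeasure_map (continuous_quadForm α β).aemeasurable⟩

lemma coe_quadFormLaw (α β : ℝ) :
    (quadFormLaw α β : Measure ℝ) = complexGaussian.map (quadForm α β) := rfl

lemma continuous_quadFormLaw : Continuous fun p : ℝ × ℝ ↦ quadFormLaw p.1 p.2 := by
  rw [ProbabilityMeasure.continuous_iff_forall_continuous_integral]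
  intro f
  simp_rw [coe_quadFormLaw, integral_map (continuous_quadForm _ _).aemeasurable
    f.continuous.aestronglyMeasurable]
  refine continuous_of_dominated (bound := fun _ ↦ ‖f‖)
    (fun p ↦ (f.continuous.comp (continuous_quadForm _ _)).aestronglyMeasurable)
    (fun p ↦ Eventually.of_forall fun z ↦ f.norm_coe_le_norm _) (integrable_const _)
    (Eventually.of_forall fun z ↦ f.continuous.comp ?_)
  unfold quadForm
  fun_prop

lemma ricianMeasure_zero_one : ricianMeasure 0 1 = nakagamiMeasure 1 1 := by
  have hpdf (x : ℝ) : ricianPDF 0 1 x = nakagamiPDF 1 1 x := by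
    have hbessel : besselI0 0 = 1 := by simp [besselI0, Real.pi_ne_zero]
    have h := ricianPDF_add_one le_rfl x
    rw [zero_add] at h
    rw [h, nakagamiPDF, show (2 : ℝ) * 1 - 1 = 1 by norm_num]
    simp [hbessel]
  simp only [ricianMeasure, nakagamiMeasure, hpdf]

lemma map_sq_norm_complexGaussian :
    complexGaussian.map (fun z ↦ ‖z‖ ^ 2) = gammaMeasure 1 1 := by
  have h := map_norm_add_complexGaussian 0
  simp only [add_zero, norm_zero, zero_pow two_ne_zero, zero_add, ricianMeasure_zero_one] at h
  rw [← map_sq_div_nakagamiMeasure one_pos one_pos, ← h,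
    Measure.map_map (by fun_prop) (by fun_prop)]
  simp only [Function.comp_def, div_one]

lemma quadFormLaw_zero_one : (quadFormLaw 0 1 : Measure ℝ) = stdGamma 1 := by
  rw [stdGamma, ← map_sq_norm_complexGaussian, Measure.map_map (by fun_prop) (by fun_prop),
    coe_quadFormLaw]
  congr 1
  ext z
  simp [quadForm]

lemma quadFormLaw_sqrt_two_zero : (quadFormLaw √2 0 : Measure ℝ) = gaussianReal 0 1 := by
  refine Measure.ext_of_charFun (funext fun ξ ↦ ?_)
  have hinner (z : ℂ) : ξ * quadForm √2 0 z = inner ℝ z ((ξ * √2 : ℝ) : ℂ) := by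
    simp [quadForm, Complex.inner]
    ring
  have hgaussian := charFun_complexGaussian ((ξ * √2 : ℝ) : ℂ)
  rw [charFun_apply] at hgaussian
  rw [charFun_gaussianReal, charFun_apply_real, coe_quadFormLaw,
    integral_map (by fun_prop) (by fun_prop)]
  simp_rw [← Complex.ofReal_mul, hinner]
  rw [hgaussian, Complex.norm_real, Real.norm_eq_abs, sq_abs, mul_pow, Real.sq_sqrt zero_le_two]
  congr 1
  push_cast
  ring

lemma stdGamma_one_real_Ioc_le (r : ℝ) {ε : ℝ} (hε : 0 ≤ ε) :
    (stdGamma 1).real (Ioc r (r + ε)) ≤ 1 * ε := by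
  have hpreimage : (fun y : ℝ ↦ √1 * (y - 1)) ⁻¹' Ioc r (r + ε) = Ioc (r + 1) (r + 1 + ε) := by
    ext y
    simp only [Real.sqrt_one, one_mul, mem_preimage, mem_Ioc, lt_sub_iff_add_lt,
      sub_le_iff_le_add, add_right_comm]
  rw [stdGamma, map_measureReal_apply (by fun_prop) measurableSet_Ioc, hpreimage,
    gammaMeasure_eq_withDensity_Ioi]
  refine withDensity_restrict_real_Ioc_le (p := gammaPDFReal 1 1) (fun x (hx : 0 < x) ↦ ?_)
    zero_le_one _ hε
  simp [gammaPDFReal, hx.le]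

lemma gaussianReal_real_Ioc_le (μ r : ℝ) {ε : ℝ} (hε : 0 ≤ ε) :
    (gaussianReal μ 1).real (Ioc r (r + ε)) ≤ 1 * ε := by
  rw [gaussianReal_of_var_ne_zero _ one_ne_zero, ← Measure.restrict_univ (μ := volume)]
  refine withDensity_restrict_real_Ioc_le (p := gaussianPDFReal μ 1) (fun x _ ↦ ?_) zero_le_one r hε
  have hsqrt : 1 ≤ √(2 * Real.pi * (1 : NNReal)) := by
    rw [Real.one_le_sqrt, NNReal.coe_one, mul_one]
    linarith [Real.pi_gt_three]
  refine mul_le_one₀ (inv_le_one_of_one_le₀ hsqrt) (Real.exp_pos _).le (Real.exp_le_one_iff.2 ?_)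
  exact div_nonpos_of_nonpos_of_nonneg (neg_nonpos.2 (sq_nonneg _)) (by positivity)

end QuadForm

section QuadFormMoments

lemma map_neg_complexGaussian : complexGaussian.map (fun z ↦ (-1 : ℝ) • z) = complexGaussian := by
  have : IsProbabilityMeasure (complexGaussian.map fun z ↦ (-1 : ℝ) • z) :=
    Measure.isProbabilityMeasure_map (by fun_prop)
  refine Measure.ext_of_charFun (funext fun ξ ↦ ?_)
  rw [charFun_map_smul, charFun_complexGaussian, charFun_complexGaussian, norm_smul, norm_neg,
    norm_one, one_mul]

lemma integral_complexGaussian_of_odd {f : ℂ → ℝ} (hf : Measurable f) (hodd : ∀ z, f (-z) = -f z) :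
    ∫ z, f z ∂complexGaussian = 0 := by
  have h : ∫ z, f z ∂complexGaussian = -∫ z, f z ∂complexGaussian := by
    conv_lhs => rw [← map_neg_complexGaussian]
    rw [integral_map (by fun_prop) hf.aestronglyMeasurable, ← integral_neg]
    simp only [neg_one_smul, hodd]
  linarith

lemma quadForm_eq_smul_add (α β : ℝ) :
    quadForm α β = (α / √2) • quadForm √2 0 + β • quadForm 0 1 := by
  ext z
  simp only [quadForm, Pi.add_apply, Pi.smul_apply, smul_eq_mul]
  field_simp
  ring

lemma memLp_quadForm_sqrt_two_zero : MemLp (quadForm √2 0) 2 complexGaussian := by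
  have h : MemLp id 2 (gaussianReal 0 1) := memLp_id_gaussianReal 2
  rw [← quadFormLaw_sqrt_two_zero] at h
  exact (memLp_map_measure_iff aestronglyMeasurable_id (by fun_prop)).1 h

lemma memLp_quadForm_zero_one : MemLp (quadForm 0 1) 2 complexGaussian := by
  have h := memLp_id_stdGamma one_pos
  rw [← quadFormLaw_zero_one] at h
  exact (memLp_map_measure_iff aestronglyMeasurable_id (by fun_prop)).1 h

lemma memLp_id_quadFormLaw (α β : ℝ) : MemLp id 2 (quadFormLaw α β : Measure ℝ) := by
  refine (memLp_map_measure_iff aestronglyMeasurable_id (by fun_prop)).2 ?_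
  rw [Function.id_comp, quadForm_eq_smul_add]
  exact (memLp_quadForm_sqrt_two_zero.const_smul _).add (memLp_quadForm_zero_one.const_smul _)

lemma integral_quadForm_sqrt_two_zero : complexGaussian[quadForm √2 0] = 0 :=
  integral_complexGaussian_of_odd (by fun_prop) fun z ↦ by simp [quadForm]

lemma integral_quadForm_zero_one : complexGaussian[quadForm 0 1] = 0 := by
  have h := integral_id_stdGamma one_pos
  rwa [← quadFormLaw_zero_one, coe_quadFormLaw, integral_map (by fun_prop) (by fun_prop)] at h

lemma integral_id_quadFormLaw (α β : ℝ) : ∫ y, y ∂(quadFormLaw α β : Measure ℝ) = 0 := by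
  rw [coe_quadFormLaw, integral_map (by fun_prop) (by fun_prop), quadForm_eq_smul_add,
    integral_add'
      ((memLp_quadForm_sqrt_two_zero.integrable one_le_two).smul _)
      ((memLp_quadForm_zero_one.integrable one_le_two).smul _)]
  simp only [Pi.smul_apply, integral_smul, integral_quadForm_sqrt_two_zero,
    integral_quadForm_zero_one, smul_zero, add_zero]

lemma covariance_quadForm_sqrt_two_zero_quadForm_zero_one :
    cov[quadForm √2 0, quadForm 0 1; complexGaussian] = 0 := by
  rw [covariance_eq_sub memLp_quadForm_sqrt_two_zero memLp_quadForm_zero_one,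
    integral_quadForm_zero_one, mul_zero, sub_zero]
  exact integral_complexGaussian_of_odd (by fun_prop) fun z ↦ by simp [quadForm]

lemma variance_id_quadFormLaw (α β : ℝ) :
    Var[id; (quadFormLaw α β : Measure ℝ)] = α ^ 2 / 2 + β ^ 2 := by
  have hre : Var[quadForm √2 0; complexGaussian] = 1 := by
    rw [← variance_id_map (by fun_prop), ← coe_quadFormLaw, quadFormLaw_sqrt_two_zero,
      variance_id_gaussianReal, NNReal.coe_one]
  have hsq : Var[quadForm 0 1; complexGaussian] = 1 := by
    rw [← variance_id_map (by fun_prop), ← coe_quadFormLaw, quadFormLaw_zero_one,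
      variance_id_stdGamma one_pos]
  rw [coe_quadFormLaw, variance_id_map (by fun_prop), quadForm_eq_smul_add,
    variance_add (memLp_quadForm_sqrt_two_zero.const_smul _)
      (memLp_quadForm_zero_one.const_smul _),
    variance_smul, variance_smul, covariance_smul_left, covariance_smul_right,
    covariance_quadForm_sqrt_two_zero_quadForm_zero_one, hre, hsq, div_pow,
    Real.sq_sqrt zero_le_two]
  ring

end QuadFormMoments

section Standardization

variable {K m c Ω : ℝ}

/-- The map that takes a random variable whose square has mean `Ω` and standard deviation `Ω / c` to
its standardised square. -/
noncomputable def standardizedSq (c Ω x : ℝ) : ℝ := c * (x ^ 2 / Ω - 1)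

@[fun_prop]
lemma measurable_standardizedSq (c Ω : ℝ) : Measurable (standardizedSq c Ω) := by
  unfold standardizedSq
  fun_prop

lemma standardizedSq_le_standardizedSq_iff (hc : 0 < c) (hΩ : 0 < Ω) {x y : ℝ} (hx : 0 ≤ x)
    (hy : 0 ≤ y) : standardizedSq c Ω y ≤ standardizedSq c Ω x ↔ y ≤ x := by
  rw [standardizedSq, standardizedSq, mul_le_mul_iff_right₀ hc, sub_le_sub_iff_right,
    div_le_div_iff_of_pos_right hΩ, sq_le_sq₀ hy hx]

lemma map_standardizedSq_real_Iic (hc : 0 < c) (hΩ : 0 < Ω) {ν : Measure ℝ}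
    (hν : ∀ᵐ x ∂ν, 0 < x) {x : ℝ} (hx : 0 ≤ x) :
    (ν.map (standardizedSq c Ω)).real (Iic (standardizedSq c Ω x)) = ν.real (Iic x) := by
  rw [map_measureReal_apply (by fun_prop) measurableSet_Iic]
  refine measureReal_congr ?_
  filter_upwards [hν] with y hy
  exact propext (standardizedSq_le_standardizedSq_iff hc hΩ hx hy.le)

lemma measureReal_Iic_of_neg {ν : Measure ℝ} (hν : ∀ᵐ x ∂ν, 0 < x) {x : ℝ} (hx : x < 0) :
    ν.real (Iic x) = 0 := by
  rw [measureReal_def, measure_eq_zero_iff_ae_notMem.2 ?_, ENNReal.toReal_zero]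
  filter_upwards [hν] with y hy
  exact not_le.2 (hx.trans hy)

lemma abs_measureReal_Iic_sub_le_of_map_standardizedSq (hc : 0 < c) (hΩ : 0 < Ω)
    {ν₁ ν₂ : Measure ℝ} (hν₁ : ∀ᵐ x ∂ν₁, 0 < x) (hν₂ : ∀ᵐ x ∂ν₂, 0 < x) {η : ℝ}
    (h : ∀ y, |(ν₁.map (standardizedSq c Ω)).real (Iic y) -
      (ν₂.map (standardizedSq c Ω)).real (Iic y)| ≤ η) (x : ℝ) :
    |ν₁.real (Iic x) - ν₂.real (Iic x)| ≤ η := by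
  rcases lt_or_ge x 0 with hx | hx
  · rw [measureReal_Iic_of_neg hν₁ hx, measureReal_Iic_of_neg hν₂ hx, sub_self, abs_zero]
    exact (abs_nonneg _).trans (h 0)
  · rw [← map_standardizedSq_real_Iic hc hΩ hν₁ hx, ← map_standardizedSq_real_Iic hc hΩ hν₂ hx]
    exact h _

lemma map_standardizedSq_nakagamiMeasure (hm : 0 < m) (hΩ : 0 < Ω) :
    (nakagamiMeasure m Ω).map (standardizedSq √m Ω) = stdGamma m := by
  rw [stdGamma, ← map_sq_div_nakagamiMeasure hm hΩ, Measure.map_map (by fun_prop) (by fun_prop)]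
  rfl

/-- The shape of the Nakagami law with the second and fourth moments of a Rician law with shape
factor `K`. -/
noncomputable def nakagamiShape (K : ℝ) : ℝ := (K + 1) ^ 2 / (2 * K + 1)

lemma nakagamiShape_pos (hK : 0 ≤ K) : 0 < nakagamiShape K := by
  rw [nakagamiShape]
  positivity

lemma sqrt_nakagamiShape (hK : 0 ≤ K) : √(nakagamiShape K) = (K + 1) / √(2 * K + 1) := by
  rw [nakagamiShape, Real.sqrt_div (by positivity), Real.sqrt_sq (by positivity)]

/-- The law of the standardised square of a Rician variable with shape factor `K`. -/
noncomputable def stdRician (K : ℝ) : ProbabilityMeasure ℝ :=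
  quadFormLaw (2 * √K / √(2 * K + 1)) (√(2 * K + 1))⁻¹

lemma variance_id_stdRician (hK : 0 ≤ K) : Var[id; (stdRician K : Measure ℝ)] = 1 := by
  rw [stdRician, variance_id_quadFormLaw, div_pow, mul_pow, inv_pow, Real.sq_sqrt hK,
    Real.sq_sqrt (by positivity)]
  field_simp

lemma sq_norm_sqrt_mul_add_sqrt {σ : ℝ} (hσ : 0 ≤ σ) (hK : 0 ≤ K) (z : ℂ) :
    ‖(√σ : ℂ) * z + (√σ * √K : ℝ)‖ ^ 2 = σ * (‖z‖ ^ 2 + 2 * √K * z.re + K) := by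
  rw [Complex.ofReal_mul, ← mul_add, norm_mul, mul_pow, Complex.norm_real, Real.norm_eq_abs,
    sq_abs, Real.sq_sqrt hσ, Complex.sq_norm, Complex.normSq_add, ← Complex.sq_norm z]
  simp only [Complex.normSq_ofReal, Real.mul_self_sqrt hK, Complex.conj_ofReal,
    Complex.re_mul_ofReal]
  ring

lemma map_norm_complexGaussian_eq_ricianMeasure (hK : 0 ≤ K) (hΩ : 0 < Ω) :
    complexGaussian.map (fun z ↦ ‖(√(Ω / (K + 1)) : ℂ) * z + (√(Ω / (K + 1)) * √K : ℝ)‖) =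
      ricianMeasure K Ω := by
  have hσ : 0 < Ω / (K + 1) := by positivity
  have hb : ‖((√(Ω / (K + 1)) * √K : ℝ) : ℂ)‖ ^ 2 = Ω / (K + 1) * K := by
    rw [Complex.norm_real, Real.norm_eq_abs, sq_abs, mul_pow, Real.sq_sqrt hσ.le, Real.sq_sqrt hK]
  rw [map_norm_sqrt_mul_add_complexGaussian hσ, hb, mul_div_cancel_left₀ _ hσ.ne']
  congr 1
  field_simp

lemma map_standardizedSq_ricianMeasure (hK : 0 ≤ K) (hΩ : 0 < Ω) :
    (ricianMeasure K Ω).map (standardizedSq √(nakagamiShape K) Ω) = stdRician K := by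
  rw [← map_norm_complexGaussian_eq_ricianMeasure hK hΩ,
    Measure.map_map (by fun_prop) (by fun_prop), stdRician, coe_quadFormLaw]
  congr 1
  ext z
  have : √(2 * K + 1) ≠ 0 := (Real.sqrt_pos.2 (by positivity)).ne'
  rw [Function.comp_apply, standardizedSq, sq_norm_sqrt_mul_add_sqrt (by positivity) hK,
    sqrt_nakagamiShape hK, quadForm]
  field_simp
  ring

lemma abs_ricianMeasure_sub_nakagamiMeasure_real_Iic_le (hK : 0 ≤ K) (hΩ : 0 < Ω) {η : ℝ}
    (h : ∀ y, |(stdRician K : Measure ℝ).real (Iic y) -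
      (stdGamma (nakagamiShape K)).real (Iic y)| ≤ η) (x : ℝ) :
    |(ricianMeasure K Ω).real (Iic x) -
      (nakagamiMeasure (nakagamiShape K) Ω).real (Iic x)| ≤ η := by
  refine abs_measureReal_Iic_sub_le_of_map_standardizedSq
    (Real.sqrt_pos.2 (nakagamiShape_pos hK)) hΩ
    (ν₁ := ricianMeasure K Ω) (ν₂ := nakagamiMeasure (nakagamiShape K) Ω)
    (ae_pos_withDensity_Ioi _) (ae_pos_withDensity_Ioi _) (fun y ↦ ?_) x
  rw [map_standardizedSq_ricianMeasure hK hΩ,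
    map_standardizedSq_nakagamiMeasure (nakagamiShape_pos hK) hΩ]
  exact h y

end Standardization

section RicianNakagami

open scoped NNReal

lemma eventually_forall_abs_stdRician_sub_stdGamma_le {l : Filter ℝ≥0} [l.IsCountablyGenerated]
    {ρ : ProbabilityMeasure ℝ} (hrice : Tendsto (fun K : ℝ≥0 ↦ stdRician K) l (𝓝 ρ))
    (hgamma : ∀ ξ, Tendsto (fun K : ℝ≥0 ↦ charFun (stdGamma (nakagamiShape K)) ξ) l
      (𝓝 (charFun (ρ : Measure ℝ) ξ)))
    {C : ℝ} (hC₀ : 0 ≤ C)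
    (hC : ∀ r ε, 0 ≤ ε → (ρ : Measure ℝ).real (Ioc r (r + ε)) ≤ C * ε) {η : ℝ} (hη : 0 < η) :
    ∀ᶠ K : ℝ≥0 in l, ∀ y, |(stdRician K : Measure ℝ).real (Iic y) -
      (stdGamma (nakagamiShape K)).real (Iic y)| ≤ η :=
  eventually_forall_abs_measureReal_Iic_sub_Iic_le hrice
    (ν' := fun K : ℝ≥0 ↦ ⟨_, isProbabilityMeasure_stdGamma (nakagamiShape_pos K.2)⟩)
    (tendsto_of_tendsto_charFun hgamma) hC₀ hC hη

lemma tendsto_stdRician_nhds_zero :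
    Tendsto (fun K : ℝ≥0 ↦ stdRician K) (𝓝 0) (𝓝 (quadFormLaw 0 1)) := by
  have hcont : ContinuousAt
      (fun K : ℝ≥0 ↦ ((2 * √(K : ℝ) / √(2 * K + 1), (√(2 * K + 1))⁻¹) : ℝ × ℝ)) 0 :=
    (ContinuousAt.div (by fun_prop) (by fun_prop) (by simp)).prodMk
      (ContinuousAt.inv₀ (by fun_prop) (by simp))
  have h := continuous_quadFormLaw.continuousAt.comp hcont
  simpa [ContinuousAt, Function.comp_def, stdRician] using h

lemma tendsto_nakagamiShape_nhds_zero :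
    Tendsto (fun K : ℝ≥0 ↦ nakagamiShape K) (𝓝 0) (𝓝 1) := by
  have hcont : ContinuousAt (fun K : ℝ≥0 ↦ ((K : ℝ) + 1) ^ 2 / (2 * K + 1)) 0 :=
    ContinuousAt.div (by fun_prop) (by fun_prop) (by simp)
  simpa [ContinuousAt, nakagamiShape] using hcont

lemma tendsto_two_mul_add_one_atTop : Tendsto (fun K : ℝ≥0 ↦ 2 * (K : ℝ) + 1) atTop atTop :=
  tendsto_atTop_add_const_right _ _
    ((NNReal.tendsto_coe_atTop.2 tendsto_id).const_mul_atTop two_pos)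

lemma tendsto_stdRician_atTop :
    Tendsto (fun K : ℝ≥0 ↦ stdRician K) atTop (𝓝 (quadFormLaw √2 0)) := by
  have hβ : Tendsto (fun K : ℝ≥0 ↦ (√(2 * (K : ℝ) + 1))⁻¹) atTop (𝓝 0) :=
    (Real.tendsto_sqrt_atTop.comp tendsto_two_mul_add_one_atTop).inv_tendsto_atTop
  have hα : Tendsto (fun K : ℝ≥0 ↦ 2 * √(K : ℝ) / √(2 * K + 1)) atTop (𝓝 √2) := by
    have hsqrt (K : ℝ≥0) : √(2 - 2 * (2 * (K : ℝ) + 1)⁻¹) = 2 * √(K : ℝ) / √(2 * K + 1) := by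
      rw [show (2 : ℝ) - 2 * (2 * (K : ℝ) + 1)⁻¹ = 2 ^ 2 * K / (2 * K + 1) by field_simp; ring,
        Real.sqrt_div (by positivity), Real.sqrt_mul (by positivity), Real.sqrt_sq zero_le_two]
    have hlim := (Real.continuous_sqrt.tendsto _).comp
      ((tendsto_two_mul_add_one_atTop.inv_tendsto_atTop.const_mul 2).const_sub 2)
    rw [mul_zero, sub_zero] at hlim
    exact hlim.congr hsqrt
  exact (continuous_quadFormLaw.tendsto (√2, 0)).comp (hα.prodMk_nhds hβ)

lemma tendsto_nakagamiShape_atTop : Tendsto (fun K : ℝ≥0 ↦ nakagamiShape K) atTop atTop := by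
  refine tendsto_atTop_mono (fun K ↦ ?_)
    ((NNReal.tendsto_coe_atTop.2 tendsto_id).atTop_div_const two_pos)
  rw [nakagamiShape, id, div_le_div_iff₀ two_pos (by positivity)]
  nlinarith [K.coe_nonneg]

lemma eventually_nhds_zero_forall_abs_stdRician_sub_stdGamma_le {η : ℝ} (hη : 0 < η) :
    ∀ᶠ K : ℝ≥0 in 𝓝 0, ∀ y, |(stdRician K : Measure ℝ).real (Iic y) -
      (stdGamma (nakagamiShape K)).real (Iic y)| ≤ η := by
  refine eventually_forall_abs_stdRician_sub_stdGamma_le tendsto_stdRician_nhds_zero (fun ξ ↦ ?_)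
    zero_le_one (fun r ε hε ↦ ?_) hη
  · rw [quadFormLaw_zero_one]
    exact (continuousAt_charFun_stdGamma one_pos ξ).tendsto.comp tendsto_nakagamiShape_nhds_zero
  · rw [quadFormLaw_zero_one]
    exact stdGamma_one_real_Ioc_le r hε

lemma eventually_atTop_forall_abs_stdRician_sub_stdGamma_le {η : ℝ} (hη : 0 < η) :
    ∀ᶠ K : ℝ≥0 in atTop, ∀ y, |(stdRician K : Measure ℝ).real (Iic y) -
      (stdGamma (nakagamiShape K)).real (Iic y)| ≤ η := by
  refine eventually_forall_abs_stdRician_sub_stdGamma_le tendsto_stdRician_atTop (fun ξ ↦ ?_)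
    zero_le_one (fun r ε hε ↦ ?_) hη
  · rw [quadFormLaw_sqrt_two_zero]
    exact (tendsto_charFun_stdGamma_atTop ξ).comp tendsto_nakagamiShape_atTop
  · rw [quadFormLaw_sqrt_two_zero]
    exact gaussianReal_real_Ioc_le 0 r hε

lemma exists_forall_abs_ricianMeasure_sub_nakagamiMeasure_le {η : ℝ} (hη : 0 < η) :
    ∃ L : ℝ, 0 < L ∧ ∀ K Ω : ℝ, 0 ≤ K → 0 < Ω → K ≤ L⁻¹ ∨ L ≤ K → ∀ x,
      |(ricianMeasure K Ω).real (Iic x) - (nakagamiMeasure (nakagamiShape K) Ω).real (Iic x)| ≤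
        η := by
  obtain ⟨a, ha, hsmall⟩ := NNReal.nhds_zero_basis.eventually_iff.1
    (eventually_nhds_zero_forall_abs_stdRician_sub_stdGamma_le hη)
  obtain ⟨A, hlarge⟩ := eventually_atTop.1
    (eventually_atTop_forall_abs_stdRician_sub_stdGamma_le hη)
  obtain ⟨L, hL⟩ := exists_gt (max a⁻¹ A)
  have hLpos : 0 < L := bot_lt_of_lt hL
  refine ⟨L, hLpos, fun K Ω hK hΩ hor ↦ ?_⟩
  lift K to ℝ≥0 using hK
  refine abs_ricianMeasure_sub_nakagamiMeasure_real_Iic_le K.2 hΩ ?_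
  rcases hor with hK | hK
  · refine hsmall (mem_Iio.2 (lt_of_le_of_lt (mod_cast hK) (inv_lt_of_inv_lt₀ ha ?_)))
    exact (le_max_left _ _).trans_lt hL
  · exact hlarge K ((le_max_right _ _).trans (hL.le.trans (mod_cast hK)))

end RicianNakagami

section Moments

variable {K m c Ω : ℝ} {ν : Measure ℝ}

lemma integral_sq_of_map_standardizedSq [IsProbabilityMeasure (ν.map (standardizedSq c Ω))]
    (hc : c ≠ 0) (hΩ : Ω ≠ 0) (hmem : MemLp id 2 (ν.map (standardizedSq c Ω)))
    (hmean : ∫ y, y ∂ν.map (standardizedSq c Ω) = 0) : ∫ x, x ^ 2 ∂ν = Ω := by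
  have hsq (x : ℝ) : x ^ 2 = Ω * (1 + c⁻¹ * standardizedSq c Ω x) := by
    rw [standardizedSq, inv_mul_cancel_left₀ hc]
    field_simp
    ring
  have hint : Integrable (fun y ↦ c⁻¹ * y) (ν.map (standardizedSq c Ω)) :=
    (hmem.integrable one_le_two).const_mul _
  simp_rw [hsq]
  rw [← integral_map (f := fun y ↦ Ω * (1 + c⁻¹ * y)) (by fun_prop) (by fun_prop),
    integral_const_mul, integral_add (integrable_const _) hint, integral_const_mul, hmean]
  simp

lemma integral_pow_four_of_map_standardizedSq [IsProbabilityMeasure (ν.map (standardizedSq c Ω))]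
    (hc : c ≠ 0) (hΩ : Ω ≠ 0) (hmem : MemLp id 2 (ν.map (standardizedSq c Ω)))
    (hmean : ∫ y, y ∂ν.map (standardizedSq c Ω) = 0)
    (hvar : Var[id; ν.map (standardizedSq c Ω)] = 1) :
    ∫ x, x ^ 4 ∂ν = Ω ^ 2 * (1 + (c ^ 2)⁻¹) := by
  have hpow (x : ℝ) : x ^ 4 = Ω ^ 2 * (1 + 2 * c⁻¹ * standardizedSq c Ω x +
      (c ^ 2)⁻¹ * standardizedSq c Ω x ^ 2) := by
    rw [standardizedSq]
    field_simp
    ring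
  have hsecond : ∫ y, y ^ 2 ∂ν.map (standardizedSq c Ω) = 1 := by
    rw [← hvar, variance_of_integral_eq_zero (X := id) (by fun_prop) hmean]
    rfl
  have hint : Integrable (fun y ↦ 2 * c⁻¹ * y) (ν.map (standardizedSq c Ω)) :=
    (hmem.integrable one_le_two).const_mul _
  have hint₂ : Integrable (fun y ↦ (c ^ 2)⁻¹ * y ^ 2) (ν.map (standardizedSq c Ω)) :=
    hmem.integrable_sq.const_mul _
  simp_rw [hpow]
  rw [← integral_map (f := fun y ↦ Ω ^ 2 * (1 + 2 * c⁻¹ * y + (c ^ 2)⁻¹ * y ^ 2))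
      (by fun_prop) (by fun_prop), integral_const_mul,
    integral_add (((integrable_const _).add hint).congr (by rfl)) hint₂,
    integral_add (integrable_const _) hint, integral_const_mul, integral_const_mul, hmean, hsecond]
  simp

lemma integral_sq_nakagamiMeasure (hm : 0 < m) (hΩ : 0 < Ω) :
    ∫ x, x ^ 2 ∂nakagamiMeasure m Ω = Ω := by
  have hmap := map_standardizedSq_nakagamiMeasure hm hΩ
  have := isProbabilityMeasure_stdGamma hm
  rw [← hmap] at this
  exact integral_sq_of_map_standardizedSq (Real.sqrt_pos.2 hm).ne' hΩ.ne'
    (hmap ▸ memLp_id_stdGamma hm) (hmap ▸ integral_id_stdGamma hm)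

lemma integral_pow_four_nakagamiMeasure (hm : 0 < m) (hΩ : 0 < Ω) :
    ∫ x, x ^ 4 ∂nakagamiMeasure m Ω = Ω ^ 2 * (1 + m⁻¹) := by
  have hmap := map_standardizedSq_nakagamiMeasure hm hΩ
  have := isProbabilityMeasure_stdGamma hm
  rw [← hmap] at this
  rw [integral_pow_four_of_map_standardizedSq (Real.sqrt_pos.2 hm).ne' hΩ.ne'
    (hmap ▸ memLp_id_stdGamma hm) (hmap ▸ integral_id_stdGamma hm)
    (hmap ▸ variance_id_stdGamma hm), Real.sq_sqrt hm.le]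

lemma integral_sq_ricianMeasure (hK : 0 ≤ K) (hΩ : 0 < Ω) :
    ∫ x, x ^ 2 ∂ricianMeasure K Ω = Ω := by
  have hmap := map_standardizedSq_ricianMeasure hK hΩ
  have : IsProbabilityMeasure (stdRician K : Measure ℝ) := inferInstance
  rw [← hmap] at this
  exact integral_sq_of_map_standardizedSq (Real.sqrt_pos.2 (nakagamiShape_pos hK)).ne' hΩ.ne'
    (hmap ▸ memLp_id_quadFormLaw _ _) (hmap ▸ integral_id_quadFormLaw _ _)

lemma integral_pow_four_ricianMeasure (hK : 0 ≤ K) (hΩ : 0 < Ω) :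
    ∫ x, x ^ 4 ∂ricianMeasure K Ω = Ω ^ 2 * (1 + (nakagamiShape K)⁻¹) := by
  have hmap := map_standardizedSq_ricianMeasure hK hΩ
  have : IsProbabilityMeasure (stdRician K : Measure ℝ) := inferInstance
  rw [← hmap] at this
  rw [integral_pow_four_of_map_standardizedSq (Real.sqrt_pos.2 (nakagamiShape_pos hK)).ne' hΩ.ne'
    (hmap ▸ memLp_id_quadFormLaw _ _) (hmap ▸ integral_id_quadFormLaw _ _)
    (hmap ▸ variance_id_stdRician hK), Real.sq_sqrt (nakagamiShape_pos hK).le]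

lemma integral_sq_eq_and_integral_pow_four_eq_iff (hK : 0 ≤ K) (hΩ : 0 < Ω) {m' Ω' : ℝ}
    (hm' : 0 < m') (hΩ' : 0 < Ω') :
    (∫ x, x ^ 2 ∂nakagamiMeasure m' Ω' = ∫ x, x ^ 2 ∂ricianMeasure K Ω ∧
      ∫ x, x ^ 4 ∂nakagamiMeasure m' Ω' = ∫ x, x ^ 4 ∂ricianMeasure K Ω) ↔
      m' = nakagamiShape K ∧ Ω' = Ω := by
  rw [integral_sq_nakagamiMeasure hm' hΩ', integral_sq_ricianMeasure hK hΩ,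
    integral_pow_four_nakagamiMeasure hm' hΩ', integral_pow_four_ricianMeasure hK hΩ,
    and_comm (b := Ω' = Ω), and_congr_right_iff]
  rintro rfl
  rw [mul_right_inj' (by positivity), add_right_inj, inv_inj]

end Moments

section EquivalentNakagami

variable {S : Type*} [MeasurableSpace S] {μ : Measure S} {X : Randomness S}
  {g : Config} {t : ℝ} {M N : ℕ}

lemma XiSq_nonneg (X : Randomness S) (μ : Measure S) (g : Config) (t : ℝ) (M N : ℕ) :
    0 ≤ XiSq X μ g t M N := by
  rw [XiSq]
  positivity

lemma Balanced.KEff_nonneg (hB : Balanced X μ g t M N) : 0 ≤ KEff X μ g t M N :=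
  div_nonneg (XiSq_nonneg X μ g t M N) hB.1.le

lemma Balanced.scale_pos (hB : Balanced X μ g t M N) : 0 < scale X μ g t M N :=
  add_pos_of_nonneg_of_pos (XiSq_nonneg X μ g t M N) hB.1

lemma Balanced.mNak_eq_nakagamiShape (hB : Balanced X μ g t M N) :
    mNak X μ g t M N = nakagamiShape (KEff X μ g t M N) := by
  have hΞ := XiSq_nonneg X μ g t M N
  have hσ := hB.1
  have hdenom : (sigma X μ g t M N + XiSq X μ g t M N) ^ 2 - XiSq X μ g t M N ^ 2 =
      sigma X μ g t M N * (2 * XiSq X μ g t M N + sigma X μ g t M N) := by ring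
  rw [mNak, KEff, nakagamiShape, hdenom]
  field_simp
  ring

namespace Randomness.IsIID

variable [IsProbabilityMeasure μ]

lemma integral_sq_norm_complexEnvelope (hX : X.IsIID μ) (g : Config) (t : ℝ) (M N : ℕ) :
    ∫ s, ‖complexEnvelope X g t M N s‖ ^ 2 ∂μ = scale X μ g t M N := by
  have hTc := hX.memLp_Tc g t M N
  have hTs := hX.memLp_Ts g t M N
  have hnorm (s : S) : ‖complexEnvelope X g t M N s‖ ^ 2 =
      Tc X g t M N s ^ 2 + Ts X g t M N s ^ 2 := by
    rw [Complex.sq_norm, Complex.normSq_apply, complexEnvelope_re, complexEnvelope_im, sq, sq]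
  simp_rw [hnorm]
  rw [integral_add hTc.integrable_sq hTs.integrable_sq, scale, XiSq, sigma, variance_eq_sub hTc,
    variance_eq_sub hTs]
  simp only [Pi.pow_apply]
  ring

lemma exists_forall_envelopeWithin (hX : X.IsIID μ) (t : ℝ) {η : ℝ} (hη : 0 < η) :
    ∃ n₀ : ℕ, ∃ L : ℝ, 0 < L ∧ ∀ M N : ℕ, n₀ ≤ M → n₀ ≤ N →
      ∀ g : Config, Balanced X μ g t M N →
        EnvelopeWithin X μ g t M N (ricianMeasure (KEff X μ g t M N) (scale X μ g t M N)) η ∧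
        (KEff X μ g t M N ≤ L⁻¹ ∨ L ≤ KEff X μ g t M N →
          EnvelopeWithin X μ g t M N
            (nakagamiMeasure (mNak X μ g t M N) (scale X μ g t M N)) η) := by
  obtain ⟨n₀, hrice⟩ := eventually_balancedAtTop.1
    (hX.eventually_envelopeWithin_ricianMeasure t (half_pos hη))
  obtain ⟨L, hL, hnak⟩ := exists_forall_abs_ricianMeasure_sub_nakagamiMeasure_le (half_pos hη)
  refine ⟨n₀, L, hL, fun M N hM hN g hB ↦
    ⟨fun x ↦ (hrice M N hM hN g hB x).trans (half_le_self hη.le), fun hK x ↦ ?_⟩⟩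
  rw [hB.mNak_eq_nakagamiShape, ← add_halves η]
  exact (abs_sub_le _ _ _).trans (add_le_add (hrice M N hM hN g hB x)
    (hnak _ _ hB.KEff_nonneg hB.scale_pos hK x))

lemma integral_complexEnvelope (hX : X.IsIID μ) (g : Config) (t : ℝ) (M N : ℕ) :
    μ[complexEnvelope X g t M N] =
      ∑ m ∈ Finset.range M, risRotation g t m μ[risPhasor X 0] + N * μ[directPhasor X t 0] := by
  have hris (m : ℕ) : Integrable (risPhasor X m) μ :=
    ((hX.identDistrib_risPhasor m).symm.memLp_snd hX.memLp_risPhasor).integrable one_le_two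
  have hdirect (n : ℕ) : Integrable (directPhasor X t n) μ :=
    ((hX.identDistrib_directPhasor t n).symm.memLp_snd (hX.memLp_directPhasor t)).integrable
      one_le_two
  have hrotated (m : ℕ) : Integrable (fun s ↦ risRotation g t m (risPhasor X m s)) μ :=
    (risRotation g t m).toContinuousLinearMap.integrable_comp (hris m)
  have hrot (m : ℕ) :
      ∫ s, risRotation g t m (risPhasor X m s) ∂μ = risRotation g t m μ[risPhasor X 0] := by
    rw [← (hX.identDistrib_risPhasor m).integral_eq]
    exact (risRotation g t m).toContinuousLinearMap.integral_comp_comm (hris m)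
  rw [complexEnvelope_eq, integral_add' ((hX.memLp_risSignal g t M).integrable one_le_two)
    ((hX.memLp_directSignal t N).integrable one_le_two)]
  simp only [risSignal, directSignal, Finset.sum_apply]
  rw [integral_finsetSum _ fun m _ ↦ hrotated m, integral_finsetSum _ fun n _ ↦ hdirect n]
  simp only [hrot, (hX.identDistrib_directPhasor t _).integral_eq, Finset.sum_const,
    Finset.card_range, nsmul_eq_mul]

lemma exists_KEff_eq_mul (hX : X.IsIID μ) (hg : ∀ m : ℕ, g.φ m = g.ε * (m + 1)) (t : ℝ) :
    ∃ κ : ℝ, 0 ≤ κ ∧ ∀ M : ℕ, KEff X μ g t M M = M * κ := by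
  have hrot (m : ℕ) : risRotation g t m = risRotation g t 0 := by
    simp only [risRotation, hg, sub_add_cancel]
  have hV₁ : 0 ≤ totalVariance μ (risPhasor X 0) := totalVariance_nonneg
  have hV₂ : 0 ≤ totalVariance μ (directPhasor X t 0) := totalVariance_nonneg
  refine ⟨‖risRotation g t 0 μ[risPhasor X 0] + μ[directPhasor X t 0]‖ ^ 2 /
    (totalVariance μ (risPhasor X 0) + totalVariance μ (directPhasor X t 0)),
    by positivity, fun M ↦ ?_⟩
  rw [KEff, hX.XiSq_eq, hX.sigma_eq, hX.integral_complexEnvelope]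
  simp only [hrot, Finset.sum_const, Finset.card_range, nsmul_eq_mul, ← mul_add, norm_mul,
    Complex.norm_natCast, mul_pow]
  rcases eq_or_ne (M : ℝ) 0 with hM | hM
  · simp only [hM, zero_mul, div_zero]
  · field_simp

lemma exists_forall_envelopeWithin_of_aligned (hX : X.IsIID μ)
    (hg : ∀ m : ℕ, g.φ m = g.ε * (m + 1)) (t : ℝ) {η : ℝ} (hη : 0 < η) :
    ∃ n₀ : ℕ, ∀ M : ℕ, n₀ ≤ M → Balanced X μ g t M M →
      EnvelopeWithin X μ g t M M (nakagamiMeasure (mNak X μ g t M M) (scale X μ g t M M)) η := by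
  obtain ⟨n₀, L, hL, h⟩ := hX.exists_forall_envelopeWithin t hη
  obtain ⟨κ, hκ, hK⟩ := hX.exists_KEff_eq_mul hg t
  rcases hκ.eq_or_lt with rfl | hκ
  · refine ⟨n₀, fun M hM hB ↦ (h M M hM hM g hB).2 (.inl ?_)⟩
    rw [hK, mul_zero]
    positivity
  · refine ⟨max n₀ ⌈L / κ⌉₊, fun M hM hB ↦ ?_⟩
    obtain ⟨hn₀, hceil⟩ := max_le_iff.1 hM
    refine (h M M hn₀ hn₀ g hB).2 (.inr ?_)
    rw [hK, ← div_le_iff₀ hκ]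
    exact Nat.ceil_le.1 hceil

end Randomness.IsIID

end EquivalentNakagami

end RIS

theorem theorem2 {S : Type*} [MeasurableSpace S] (μ : Measure S) [IsProbabilityMeasure μ]
    (X : RIS.Randomness S) (hX : X.IsIID μ) (t : ℝ) :
    -- Rician approximation, and Nakagami approximation for small or large effective shape factor,
    -- uniformly in the deterministic parameters
    (∀ η : ℝ, 0 < η → ∃ n₀ : ℕ, ∃ L : ℝ, 0 < L ∧ ∀ M N : ℕ, n₀ ≤ M → n₀ ≤ N →
      ∀ g : RIS.Config, RIS.Balanced X μ g t M N →
        RIS.EnvelopeWithin X μ g t M N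
          (RIS.ricianMeasure (RIS.KEff X μ g t M N) (RIS.scale X μ g t M N)) η ∧
        (RIS.KEff X μ g t M N ≤ L⁻¹ ∨ L ≤ RIS.KEff X μ g t M N →
          RIS.EnvelopeWithin X μ g t M N
            (RIS.nakagamiMeasure (RIS.mNak X μ g t M N) (RIS.scale X μ g t M N)) η)) ∧
    -- Nakagami approximation for as many multipath components as columns, when the terms of the RIS
    -- link are identically distributed because the nominal phase shifts are aligned
    (∀ g : RIS.Config, (∀ m : ℕ, g.φ m = g.ε * (m + 1)) →
      ∀ η : ℝ, 0 < η → ∃ n₀ : ℕ, ∀ M : ℕ, n₀ ≤ M → RIS.Balanced X μ g t M M →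
        RIS.EnvelopeWithin X μ g t M M
          (RIS.nakagamiMeasure (RIS.mNak X μ g t M M) (RIS.scale X μ g t M M)) η) ∧
    -- for all numbers of components, the scale factor is the mean square of the envelope, and the
    -- Nakagami law is the one equivalent to the Rician law: equal second and fourth moments
    (∀ (M N : ℕ) (g : RIS.Config), RIS.Balanced X μ g t M N →
      ∫ s, ‖RIS.complexEnvelope X g t M N s‖ ^ 2 ∂μ = RIS.scale X μ g t M N ∧
      0 < RIS.mNak X μ g t M N ∧
      ∀ m' Ω' : ℝ, 0 < m' → 0 < Ω' →
        ((∫ x, x ^ 2 ∂(RIS.nakagamiMeasure m' Ω') =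
            ∫ x, x ^ 2 ∂(RIS.ricianMeasure (RIS.KEff X μ g t M N) (RIS.scale X μ g t M N)) ∧
          ∫ x, x ^ 4 ∂(RIS.nakagamiMeasure m' Ω') =
            ∫ x, x ^ 4 ∂(RIS.ricianMeasure (RIS.KEff X μ g t M N) (RIS.scale X μ g t M N))) ↔
          m' = RIS.mNak X μ g t M N ∧ Ω' = RIS.scale X μ g t M N)) := by
  refine ⟨fun η hη ↦ hX.exists_forall_envelopeWithin t hη,
    fun g hg η hη ↦ hX.exists_forall_envelopeWithin_of_aligned hg t hη, fun M N g hB ↦ ?_⟩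
  rw [hB.mNak_eq_nakagamiShape]
  exact ⟨hX.integral_sq_norm_complexEnvelope g t M N, RIS.nakagamiShape_pos hB.KEff_nonneg,
    fun m' Ω' ↦ RIS.integral_sq_eq_and_integral_pow_four_eq_iff hB.KEff_nonneg hB.scale_pos⟩
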